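/- Let $\Gamma$ be a finitely generated group, $S$ a finite generating set, and $G$ the left Cayley graph of $\Gamma$ (distinct $x,y\in\Gamma$ are adjacent iff $y=sx$ for some $s\in S\cup S^{-1}$). Let $w:\Gamma\to(0,\infty)$ be balanced, i.e. there is $C>1$ with $\frac1C<\frac{w(y)}{w(x)}<C$ for all adjacent $x,y$. Write $w(H)=\sum_{x\in H}w(x)$ for finite $H$. Let $(F_n)$ be a $w$-Følner sequence: a sequence of nonempty finite subsets of $\Gamma$ such that for every $\varepsilon>0$ and finite $L\subset\Gamma$ there is $n_{\varepsilon,L}$ with $\frac{w(gF_n\cup F_n)}{w(F_n)}<1+\varepsilon$ for all $n\ge n_{\varepsilon,L}$ and $g\in L$. Assume that $\Gamma$ is weighted hyperfinite, i.e. for some finite generating set the Cayley graph has the following property: for every $\varepsilon>0$ there is $K_\varepsilon$ such that for every finite induced subgraph $L$ and every nonnegative function $v$ on the vertex set $V(L)$ of $L$ there is a set $M\subseteq V(L)$ with $\sum_{x\in M}v(x)\le\varepsilon\sum_{x\in V(L)}v(x)$ such that, after deleting $M$ from $L$, all remaining connected components have at most $K_\varepsilon$ vertices. Let $\omega$ be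 a nonprincipal ultrafilter on $\mathbb N$, let $\mu_{F,\omega}$ be the mean on bounded functions $f:\Gamma\to\mathbb R$ given by $$\int_\Gamma f\,d\mu_{F,\omega}=\lim_{\omega}\frac{\sum_{x\in F_n}f(x)w(x)}{\sum_{x\in F_n}w(x)},$$ and let $\widetilde\mu_{F,\omega}$ be the regular Borel measure on the Stone–Čech compactification $\beta\Gamma$ (the space of ultrafilters on $\Gamma$, on which $\Gamma$ acts by left translation) that the Riesz representation theorem attaches to the functional $f_*\mapsto\int_\Gamma f\,d\mu_{F,\omega}$, where $f_*\in C(\beta\Gamma)$ is the continuous extension of $f$. Then $\widetilde\mu_{F,\omega}$ is a probability measure, the action of $\Gamma$ on $\beta\Gamma$ is free, and it is Zimmer amenable with respect to $\widetilde\mu_{F,\omega}$. That is: the action preserves the measure class of $\widetilde\mu_{F,\omega}$; it is hyperfinite, meaning that there are equivalence relations $R_1\subseteq R_2\subseteq\cdots$ on $\beta\Gamma$, Borel as subsets of the topological space $\beta\Gamma\times\beta\Gamma$, with finite classes, contained in the orbit equivalence relation $E$, such that $\bigcup_n R_n=E$ modulo a $\widetilde\mu_{F,\omega}$-null set of points;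 and almost all point stabilizers are amenable. -/

import Mathlib

open MeasureTheory Filter Topology CompactlySupported

noncomputable section

/-! ### Weighted hyperfinite graphs and groups -/

/-- `M` is a `(w, ε)`-separating set for the subgraph of `G` induced on the finite vertex set `L`,
with component sizes at most `K`: `M ⊆ L`, the weight of `M` is at most `ε` times that of `L`, and
after deletion of `M` all connected components have at most `K` vertices. -/
def IsSeparatingSet {V : Type*} (G : SimpleGraph V) (L : Finset V) (w : V → ℝ) (ε : ℝ) (K : ℕ)
    (M : Finset V) : Prop :=
  M ⊆ L ∧ ∑ x ∈ M, w x ≤ ε * ∑ x ∈ L, w x ∧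
    ∀ c : (G.induce ((L : Set V) \ (M : Set V))).ConnectedComponent, c.supp.ncard ≤ K

/-- Weighted hyperfiniteness of a graph: the bound `K` depends on `ε` only, not on the finite
induced subgraph and not on the nonnegative weight function on its vertices. -/
def IsWeightedHyperfinite {V : Type*} (G : SimpleGraph V) : Prop :=
  ∀ ε : ℝ, 0 < ε → ∃ K : ℕ, ∀ (L : Finset V) (w : V → ℝ), (∀ x ∈ L, 0 ≤ w x) →
    ∃ M : Finset V, IsSeparatingSet G L w ε K M

/-- The left Cayley graph: distinct `x` and `y` are adjacent iff `y = s * x` for some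
`s ∈ S ∪ S⁻¹`. -/
def leftCayleyGraph {Γ : Type*} [Group Γ] (S : Finset Γ) : SimpleGraph Γ :=
  SimpleGraph.fromRel fun x y => ∃ s ∈ S, y = s * x

/-- A group is weighted hyperfinite if its Cayley graph with respect to some finite generating
set is. -/
def IsWeightedHyperfiniteGroup (Γ : Type*) [Group Γ] : Prop :=
  ∃ S : Finset Γ, Subgroup.closure (S : Set Γ) = ⊤ ∧ IsWeightedHyperfinite (leftCayleyGraph S)

/-! ### Balanced weights and weighted Følner sequences -/

/-- A weight function whose ratios along edges are bounded from above and from below. -/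
def IsBalanced {V : Type*} (G : SimpleGraph V) (w : V → ℝ) : Prop :=
  ∃ C : ℝ, 1 < C ∧ ∀ x y : V, G.Adj x y → 1 / C < w y / w x ∧ w y / w x < C

open Classical in
/-- `w`-Følner sequences for the left action of a group on itself. -/
def IsWeightedFolner {Γ : Type*} [Group Γ] (w : Γ → ℝ) (F : ℕ → Finset Γ) : Prop :=
  (∀ n, (F n).Nonempty) ∧
    ∀ ε : ℝ, 0 < ε → ∀ L : Finset Γ, ∃ N : ℕ, ∀ n ≥ N, ∀ g ∈ L,
      (∑ x ∈ (F n).image (fun x => g * x) ∪ F n, w x) / (∑ x ∈ F n, w x) < 1 + ε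

/-! ### The Stone–Čech compactification of a discrete group

`βΓ` is the space `Ultrafilter Γ`, with the topology generated by the sets of all ultrafilters
containing a given subset of `Γ`. -/

/-- The action of `Γ` on its ultrafilters: `A ∈ u` iff `g A ∈ g • u`. -/
instance ultrafilterMulAction (Γ : Type*) [Group Γ] : MulAction Γ (Ultrafilter Γ) where
  smul g u := u.map (fun x => g * x)
  one_smul u := by
    change u.map (fun x => 1 * x) = u
    simp only [one_mul]
    exact Ultrafilter.map_id' u
  mul_smul g h u := by
    change u.map (fun x => g * h * x) = (u.map (fun x => h * x)).map (fun x => g * x)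
    rw [Ultrafilter.map_map]
    congr 1
    funext x
    exact mul_assoc g h x

instance ultrafilterMeasurableSpace (Γ : Type*) : MeasurableSpace (Ultrafilter Γ) :=
  borel (Ultrafilter Γ)

instance ultrafilterBorelSpace (Γ : Type*) : BorelSpace (Ultrafilter Γ) := ⟨rfl⟩

/-! ### The mean and the measure of a weighted Følner sequence -/

/-- The weighted average of `f` over a finite set. -/
def weightedAverage {Γ : Type*} (w : Γ → ℝ) (F : Finset Γ) (f : Γ → ℝ) : ℝ :=
  (∑ x ∈ F, f x * w x) / ∑ x ∈ F, w x

/-- The integral of a bounded function `f` with respect to the mean `μ_{F,ω}`: the limit along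
the ultrafilter `ω` of the weighted averages of `f` over the sets `F n`. The mean of a set is the
integral of its indicator function. -/
def meanIntegral {Γ : Type*} (w : Γ → ℝ) (F : ℕ → Finset Γ) (ω : Ultrafilter ℕ) (f : Γ → ℝ) : ℝ :=
  limUnder (ω : Filter ℕ) fun n => weightedAverage w (F n) f

theorem abs_weightedAverage_le {Γ : Type*} {w : Γ → ℝ} (hw : ∀ x, 0 < w x) (F : Finset Γ)
    {f : Γ → ℝ} {B : ℝ} (hf : ∀ x, |f x| ≤ B) (hB : 0 ≤ B) : |weightedAverage w F f| ≤ B := by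
  have h0 : 0 ≤ ∑ x ∈ F, w x := Finset.sum_nonneg fun x _ => (hw x).le
  unfold weightedAverage
  rw [abs_div, abs_of_nonneg h0]
  refine div_le_of_le_mul₀ h0 hB ?_
  calc |∑ x ∈ F, f x * w x| ≤ ∑ x ∈ F, |f x * w x| := Finset.abs_sum_le_sum_abs _ _
    _ ≤ ∑ x ∈ F, B * w x := by
        refine Finset.sum_le_sum fun x _ => ?_
        rw [abs_mul, abs_of_pos (hw x)]
        exact mul_le_mul_of_nonneg_right (hf x) (hw x).le
    _ = B * ∑ x ∈ F, w x := (Finset.mul_sum _ _ _).symm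

/-- The limit that defines `meanIntegral` exists for bounded functions. -/
theorem tendsto_meanIntegral {Γ : Type*} {w : Γ → ℝ} (hw : ∀ x, 0 < w x) (F : ℕ → Finset Γ)
    (ω : Ultrafilter ℕ) {f : Γ → ℝ} (hf : ∃ B, ∀ x, |f x| ≤ B) :
    Tendsto (fun n => weightedAverage w (F n) f) ω (𝓝 (meanIntegral w F ω f)) := by
  obtain ⟨B, hB⟩ := hf
  refine tendsto_nhds_limUnder ?_
  have hK : IsCompact (Set.Icc (-|B|) |B|) := isCompact_Icc
  obtain ⟨a, -, ha⟩ := isCompact_iff_ultrafilter_le_nhds.1 hK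
    (ω.map fun n => weightedAverage w (F n) f) (by
      rw [le_principal_iff, Ultrafilter.coe_map]
      exact Filter.mem_map.2 <| Filter.univ_mem' fun n => abs_le.1 (abs_weightedAverage_le hw (F n)
        (fun x => (hB x).trans (le_abs_self B)) (abs_nonneg B)))
  exact ⟨a, ha⟩

/-- A continuous function on `βΓ` restricts to a bounded function on `Γ`. -/
theorem exists_bound_comp_pure {Γ : Type*} (f : C_c(Ultrafilter Γ, ℝ)) :
    ∃ B, ∀ x : Γ, |f (pure x)| ≤ B := by
  obtain ⟨B, hB⟩ := (isCompact_range f.continuous).isBounded.exists_norm_le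
  exact ⟨B, fun x => hB _ ⟨pure x, rfl⟩⟩

/-- The positive functional `F_* ↦ ∫ F dμ_{F,ω}` on the continuous functions on `βΓ`; these are
the unique continuous extensions `F_*` of the bounded functions `F` on `Γ`. -/
def folnerFunctional {Γ : Type*} (w : Γ → ℝ) (hw : ∀ x, 0 < w x) (F : ℕ → Finset Γ)
    (ω : Ultrafilter ℕ) : C_c(Ultrafilter Γ, ℝ) →ₚ[ℝ] ℝ :=
  PositiveLinearMap.mk₀
    { toFun := fun f => meanIntegral w F ω fun x => f (pure x)
      map_add' := fun f g => by
        refine tendsto_nhds_unique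
          (tendsto_meanIntegral hw F ω (exists_bound_comp_pure (f + g))) ?_
        refine ((tendsto_meanIntegral hw F ω (exists_bound_comp_pure f)).add
          (tendsto_meanIntegral hw F ω (exists_bound_comp_pure g))).congr fun n => ?_
        simp only [weightedAverage, CompactlySupportedContinuousMap.coe_add, Pi.add_apply,
          add_mul, Finset.sum_add_distrib, add_div]
      map_smul' := fun c f => by
        refine tendsto_nhds_unique
          (tendsto_meanIntegral hw F ω (exists_bound_comp_pure (c • f))) ?_
        refine ((tendsto_meanIntegral hw F ω (exists_bound_comp_pure f)).const_mul c).congr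
          fun n => ?_
        simp only [weightedAverage, CompactlySupportedContinuousMap.coe_smul, Pi.smul_apply,
          smul_eq_mul, mul_assoc, ← Finset.mul_sum, mul_div_assoc] }
    fun f hf => by
      refine ge_of_tendsto' (tendsto_meanIntegral hw F ω (exists_bound_comp_pure f)) fun n => ?_
      exact div_nonneg (Finset.sum_nonneg fun x _ => mul_nonneg (hf _) (hw x).le)
        (Finset.sum_nonneg fun x _ => (hw x).le)

/-- The regular Borel measure on `βΓ` that represents the mean `μ_{F,ω}`. -/
def folnerMeasure {Γ : Type*} (w : Γ → ℝ) (hw : ∀ x, 0 < w x) (F : ℕ → Finset Γ)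
    (ω : Ultrafilter ℕ) : Measure (Ultrafilter Γ) :=
  RealRMK.rieszMeasure (folnerFunctional w hw F ω)

/-! ### Zimmer amenability -/

/-- Amenability of a discrete group: there is a left-invariant finitely additive probability
measure on all of its subsets. -/
def IsAmenableGroup (H : Type*) [Group H] : Prop :=
  ∃ m : Set H → ℝ, (∀ A, 0 ≤ m A) ∧ m Set.univ = 1 ∧
    (∀ A B, Disjoint A B → m (A ∪ B) = m A + m B) ∧
    ∀ (g : H) (A : Set H), m ((fun x => g * x) '' A) = m A

/-- Hyperfiniteness of the orbit equivalence relation modulo `ν`: an increasing sequence of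
Borel subrelations with finite classes exhausts the orbit equivalence relation outside a null set.
Relations are Borel for the product topology on `Y × Y`; if `Y` is not second countable, this
σ-algebra is larger than the product σ-algebra, which need not contain even the diagonal. -/
def IsHyperfiniteAction (Γ : Type*) [Group Γ] {Y : Type*} [TopologicalSpace Y] [MeasurableSpace Y]
    [MulAction Γ Y] (ν : Measure Y) : Prop :=
  ∃ R : ℕ → Setoid Y,
    (∀ n, MeasurableSet[borel (Y × Y)] {p : Y × Y | R n p.1 p.2}) ∧
    (∀ n x, {y | R n x y}.Finite) ∧
    (∀ n, R n ≤ R (n + 1)) ∧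
    (∀ n, R n ≤ MulAction.orbitRel Γ Y) ∧
    ∀ᵐ x ∂ν, ∀ y, MulAction.orbitRel Γ Y x y → ∃ n, R n x y

/-- Zimmer amenability of an action with respect to a measure: the action preserves the measure
class, it is hyperfinite, and almost all point stabilizers are amenable. -/
def IsZimmerAmenable (Γ : Type*) [Group Γ] {Y : Type*} [TopologicalSpace Y] [MeasurableSpace Y]
    [MulAction Γ Y] (ν : Measure Y) : Prop :=
  (∀ g : Γ, Measure.QuasiMeasurePreserving (fun y : Y => g • y) ν ν) ∧
    IsHyperfiniteAction Γ ν ∧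
    ∀ᵐ y ∂ν, IsAmenableGroup (MulAction.stabilizer Γ y)

end

/-! Freeness is a colouring argument and makes all stabilizers trivial; regularity turns
quasi-invariance of the mean, which rests on balancedness, into quasi-invariance of the measure. The
substance is hyperfiniteness. A partition of Γ whose displacements `y * x⁻¹` stay in a finite set
induces on βΓ a closed relation with finite classes. By Borel–Cantelli it therefore suffices to
find, for each finite `L` and `ε > 0`, one such partition that separates `x` from some `g * x`, `g ∈
L`, only on a set of mean at most `ε` (`exists_setoid_setMean_le`).

Weighted hyperfiniteness controls partitions on one finite set at a time
(`IsWeightedHyperfiniteGroup.exists_setoid`), and the partitions for different `F n` need not agree.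
Their classes, however, have finitely many shapes. Averaging and passing to the limit, any `A ⊆ Γ`
has one shape whose tiles have small boundary relative to `A` and whose centres have at least a
fixed fraction of the mean of `A` (`exists_tile_shape`). By quasi-invariance, a maximal disjoint
family of these tiles covers a definite fraction of `A`. Continuing in the uncovered part, phrased
as a supremum argument, leaves only a set of small mean. -/

/-! ### Freeness and topology of the action on βΓ -/

section WeightedMean

/-- Left translation by a nontrivial group element fixes no ultrafilter. -/
theorem smul_ultrafilter_ne {Γ : Type*} [Group Γ] {g : Γ} (hg : g ≠ 1) (z : Ultrafilter Γ) :
    g • z ≠ z := by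
  intro hz
  -- Take `A` maximal among the sets disjoint from their preimage under `g`. By maximality `A` and
  -- its preimages under `g` and `g⁻¹` cover Γ. If `g • z = z`, then `z` contains all three or none,
  -- hence two disjoint sets.
  obtain ⟨A, hA⟩ := zorn_subset {A : Set Γ | ∀ x ∈ A, g * x ∉ A} (by
    intro c hc hchain
    refine ⟨⋃₀ c, ?_, fun s hs => Set.subset_sUnion_of_mem hs⟩
    rintro x ⟨s, hs, hxs⟩ ⟨t, ht, hxt⟩
    rcases hchain.total hs ht with h | h
    · exact hc ht x (h hxs) hxt
    · exact hc hs x hxs (h hxt))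
  have key : ∀ x, x ∈ A ∨ g * x ∈ A ∨ g⁻¹ * x ∈ A := by
    intro x
    by_contra! h
    obtain ⟨h1, h2, h3⟩ := h
    refine h1 (hA.2 (y := insert x A) ?_ (Set.subset_insert _ _) (Set.mem_insert _ _))
    rintro y (rfl | hy) (h | h)
    · exact hg (mul_eq_right.1 h)
    · exact h2 h
    · exact h3 (by rwa [← h, inv_mul_cancel_left])
    · exact hA.1 y hy h
  have hmem : ∀ B : Set Γ, B ∈ z ↔ (fun x => g * x) ⁻¹' B ∈ z := fun B => by
    conv_lhs => rw [← hz]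
    exact Iff.rfl
  have hcov : A ∪ ((fun x => g * x) ⁻¹' A ∪ (fun x => g⁻¹ * x) ⁻¹' A) ∈ z :=
    Filter.univ_mem' key
  have hAz : A ∈ z := by
    rcases Ultrafilter.union_mem_iff.1 hcov with h | h
    · exact h
    rcases Ultrafilter.union_mem_iff.1 h with h | h
    · exact (hmem A).2 h
    · rw [hmem] at h
      convert h using 1
      ext x
      simp
  obtain ⟨x, hx1, hx2⟩ := Ultrafilter.nonempty_of_mem (inter_mem hAz ((hmem A).1 hAz))
  exact hA.1 x hx1 hx2

theorem continuous_smul_ultrafilter {Γ : Type*} [Group Γ] (g : Γ) :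
    Continuous fun z : Ultrafilter Γ => g • z := by
  refine continuous_generateFrom_iff.2 ?_
  rintro _ ⟨A, rfl⟩
  exact ultrafilter_isOpen_basic ((fun x => g * x) ⁻¹' A)

/-- Compact subsets of open sets of ultrafilters are separated by basic clopen sets. -/
theorem exists_basic_between {Γ : Type*} {K U : Set (Ultrafilter Γ)} (hK : IsCompact K)
    (hU : IsOpen U) (hKU : K ⊆ U) :
    ∃ A : Set Γ, K ⊆ {u | A ∈ u} ∧ {u : Ultrafilter Γ | A ∈ u} ⊆ U := by
  refine hK.induction_on (p := fun K => ∃ A : Set Γ, K ⊆ {u | A ∈ u} ∧ {u | A ∈ u} ⊆ U)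
    ?_ ?_ ?_ ?_
  · exact ⟨∅, by simp, fun u hu => (Ultrafilter.empty_notMem hu).elim⟩
  · rintro s t hst ⟨A, h1, h2⟩
    exact ⟨A, hst.trans h1, h2⟩
  · rintro s t ⟨A, h1, h2⟩ ⟨B, h3, h4⟩
    refine ⟨A ∪ B, ?_, fun u hu => ?_⟩
    · rintro u (hu | hu)
      · exact mem_of_superset (h1 hu) Set.subset_union_left
      · exact mem_of_superset (h3 hu) Set.subset_union_right
    · rcases Ultrafilter.union_mem_iff.1 hu with h | h
      · exact h2 h
      · exact h4 h
  · intro u hu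
    obtain ⟨_, ⟨A, rfl⟩, hA, hAU⟩ :=
      ultrafilterBasis_is_basis.exists_subset_of_mem_open (hKU hu) hU
    exact ⟨_, mem_nhdsWithin_of_mem_nhds ((ultrafilter_isOpen_basic A).mem_nhds hA), A,
      subset_rfl, hAU⟩

/-! ### The mean as a finitely additive set function -/

/-- The mean of a set with respect to a sequence of weighted finite sets. -/
noncomputable def setMean {Γ : Type*} (w : Γ → ℝ) (F : ℕ → Finset Γ) (ω : Ultrafilter ℕ)
    (A : Set Γ) : ℝ :=
  meanIntegral w F ω (A.indicator 1)

open scoped Classical in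
theorem tendsto_setMean {Γ : Type*} {w : Γ → ℝ} (hw : ∀ x, 0 < w x) (F : ℕ → Finset Γ)
    (ω : Ultrafilter ℕ) (A : Set Γ) :
    Tendsto (fun n => (∑ x ∈ F n with x ∈ A, w x) / ∑ x ∈ F n, w x) ω (𝓝 (setMean w F ω A)) := by
  refine (tendsto_meanIntegral hw F ω (f := A.indicator 1) ⟨1, fun x => ?_⟩).congr fun n => ?_
  · by_cases h : x ∈ A <;> simp [h]
  · unfold weightedAverage
    congr 1
    rw [Finset.sum_filter]
    refine Finset.sum_congr rfl fun x _ => ?_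
    by_cases h : x ∈ A <;> simp [h]

theorem weight_pos {Γ : Type*} {w : Γ → ℝ} (hw : ∀ x, 0 < w x) {F : Finset Γ}
    (hF : F.Nonempty) : 0 < ∑ x ∈ F, w x :=
  Finset.sum_pos (fun x _ => hw x) hF

/-- The indicator function of a basic clopen set of ultrafilters. -/
noncomputable def basicIndicator {Γ : Type*} (A : Set Γ) : C_c(Ultrafilter Γ, ℝ) where
  toFun := {u : Ultrafilter Γ | A ∈ u}.indicator 1
  continuous_toFun := (IsClopen.continuous_indicator
    ⟨ultrafilter_isClosed_basic A, ultrafilter_isOpen_basic A⟩ continuous_const)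
  hasCompactSupport' := HasCompactSupport.of_compactSpace _

instance isFiniteMeasure_folnerMeasure {Γ : Type*} (w : Γ → ℝ) (hw : ∀ x, 0 < w x)
    (F : ℕ → Finset Γ) (ω : Ultrafilter ℕ) : IsFiniteMeasure (folnerMeasure w hw F ω) := by
  unfold folnerMeasure
  infer_instance

instance regular_folnerMeasure {Γ : Type*} (w : Γ → ℝ) (hw : ∀ x, 0 < w x)
    (F : ℕ → Finset Γ) (ω : Ultrafilter ℕ) : (folnerMeasure w hw F ω).Regular := by
  unfold folnerMeasure
  infer_instance

/-- The set is clopen, so its indicator is continuous and the Riesz formula applies to it directly.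
All measure estimates on βΓ go through this identity. -/
theorem folnerMeasure_basic {Γ : Type*} (w : Γ → ℝ) (hw : ∀ x, 0 < w x)
    (F : ℕ → Finset Γ) (ω : Ultrafilter ℕ) (A : Set Γ) :
    folnerMeasure w hw F ω {u | A ∈ u} = ENNReal.ofReal (setMean w F ω A) := by
  have h : ∫ u, basicIndicator A u ∂(folnerMeasure w hw F ω)
      = folnerFunctional w hw F ω (basicIndicator A) :=
    RealRMK.integral_rieszMeasure _ _
  have h1 : ∫ u, basicIndicator A u ∂(folnerMeasure w hw F ω)
      = (folnerMeasure w hw F ω).real {u | A ∈ u} :=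
    integral_indicator_one (ultrafilter_isOpen_basic A).measurableSet
  have h2 : folnerFunctional w hw F ω (basicIndicator A) = setMean w F ω A := by
    change meanIntegral w F ω (fun x => basicIndicator A (pure x)) = _
    unfold setMean
    congr 1
  rw [← h2, ← h, h1, ofReal_measureReal]

theorem setMean_univ {Γ : Type*} {w : Γ → ℝ} (hw : ∀ x, 0 < w x) {F : ℕ → Finset Γ}
    (hF : ∀ n, (F n).Nonempty) (ω : Ultrafilter ℕ) : setMean w F ω Set.univ = 1 := by
  classical
  refine tendsto_nhds_unique (tendsto_setMean hw F ω Set.univ) ?_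
  refine tendsto_const_nhds.congr fun n => ?_
  simp [(weight_pos hw (hF n)).ne']

theorem setMean_mono {Γ : Type*} {w : Γ → ℝ} (hw : ∀ x, 0 < w x) (F : ℕ → Finset Γ)
    (ω : Ultrafilter ℕ) {A B : Set Γ} (h : A ⊆ B) : setMean w F ω A ≤ setMean w F ω B := by
  classical
  refine le_of_tendsto_of_tendsto' (tendsto_setMean hw F ω A) (tendsto_setMean hw F ω B)
    fun n => ?_
  refine div_le_div_of_nonneg_right ?_ (Finset.sum_nonneg fun x _ => (hw x).le)
  exact Finset.sum_le_sum_of_subset_of_nonneg (Finset.monotone_filter_right _ (fun x _ hx => h hx))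
    fun x _ _ => (hw x).le

theorem setMean_nonneg {Γ : Type*} {w : Γ → ℝ} (hw : ∀ x, 0 < w x) (F : ℕ → Finset Γ)
    (ω : Ultrafilter ℕ) (A : Set Γ) : 0 ≤ setMean w F ω A := by
  classical
  refine ge_of_tendsto' (tendsto_setMean hw F ω A) fun n => ?_
  exact div_nonneg (Finset.sum_nonneg fun x _ => (hw x).le)
    (Finset.sum_nonneg fun x _ => (hw x).le)

theorem setMean_union_of_disjoint {Γ : Type*} {w : Γ → ℝ} (hw : ∀ x, 0 < w x) (F : ℕ → Finset Γ)
    (ω : Ultrafilter ℕ) {A B : Set Γ} (h : Disjoint A B) :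
    setMean w F ω (A ∪ B) = setMean w F ω A + setMean w F ω B := by
  classical
  refine tendsto_nhds_unique (tendsto_setMean hw F ω (A ∪ B)) ?_
  refine ((tendsto_setMean hw F ω A).add (tendsto_setMean hw F ω B)).congr fun n => ?_
  rw [← add_div, ← Finset.sum_union]
  · congr 2
    ext x
    simp [and_or_left]
  · rw [Finset.disjoint_filter]
    exact fun x _ hx => Set.disjoint_left.1 h hx

theorem setMean_union_le {Γ : Type*} {w : Γ → ℝ} (hw : ∀ x, 0 < w x) (F : ℕ → Finset Γ)
    (ω : Ultrafilter ℕ) (A B : Set Γ) :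
    setMean w F ω (A ∪ B) ≤ setMean w F ω A + setMean w F ω B := by
  rw [← Set.union_sdiff_self, setMean_union_of_disjoint hw F ω Set.disjoint_sdiff_right]
  gcongr
  exact setMean_mono hw F ω Set.sdiff_subset

theorem setMean_empty {Γ : Type*} {w : Γ → ℝ} (hw : ∀ x, 0 < w x) (F : ℕ → Finset Γ)
    (ω : Ultrafilter ℕ) : setMean w F ω ∅ = 0 := by
  have := setMean_union_of_disjoint hw F ω (Set.disjoint_empty (∅ : Set Γ))
  rw [Set.union_empty] at this
  linarith

theorem setMean_biUnion_le {Γ ι : Type*} {w : Γ → ℝ} (hw : ∀ x, 0 < w x) (F : ℕ → Finset Γ)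
    (ω : Ultrafilter ℕ) (s : Finset ι) (A : ι → Set Γ) :
    setMean w F ω (⋃ i ∈ s, A i) ≤ ∑ i ∈ s, setMean w F ω (A i) := by
  classical
  induction s using Finset.induction_on with
  | empty => simp [setMean_empty hw]
  | insert a s ha ih =>
    rw [Finset.set_biUnion_insert, Finset.sum_insert ha]
    exact (setMean_union_le hw F ω _ _).trans (by gcongr)

/-! ### Quasi-invariance of the mean and of the measure -/

/-- A balanced weight changes under a left translation by a bounded factor. -/
theorem exists_weight_translate_le {Γ : Type*} [Group Γ] {S : Finset Γ}
    (hS : Subgroup.closure (S : Set Γ) = ⊤) {w : Γ → ℝ} (hw : ∀ x, 0 < w x)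
    (hbal : IsBalanced (leftCayleyGraph S) w) :
    ∃ c : Γ → ℝ, (∀ g, 0 ≤ c g) ∧ ∀ g x, w (g * x) ≤ c g * w x := by
  obtain ⟨C, hC, h⟩ := hbal
  have hadj : ∀ x y, (leftCayleyGraph S).Adj x y → w y ≤ C * w x := fun x y hxy =>
    ((div_lt_iff₀ (hw x)).1 (h x y hxy).2).le
  have hs : ∀ s ∈ S, ∀ x, w (s * x) ≤ C * w x ∧ w x ≤ C * w (s * x) := by
    intro s hs x
    -- For `s = 1` there is no edge, and the bounds follow from `1 < C`.
    by_cases hx : x = s * x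
    · rw [← hx]
      have := hw x
      constructor <;> nlinarith
    · have : (leftCayleyGraph S).Adj x (s * x) :=
        (SimpleGraph.fromRel_adj _ _ _).2 ⟨hx, Or.inl ⟨s, hs, rfl⟩⟩
      exact ⟨hadj _ _ this, hadj _ _ this.symm⟩
  have : ∀ g : Γ, ∃ c : ℝ, 0 ≤ c ∧ ∀ x, w (g * x) ≤ c * w x := by
    intro g
    have hg : g ∈ Subgroup.closure (S : Set Γ) := hS ▸ Subgroup.mem_top g
    induction hg using Subgroup.closure_induction'' with
    | one => exact ⟨1, zero_le_one, fun x => by simp⟩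
    | mem s hs' => exact ⟨C, by linarith, fun x => (hs s hs' x).1⟩
    | inv_mem s hs' =>
      refine ⟨C, by linarith, fun x => ?_⟩
      simpa using (hs s hs' (s⁻¹ * x)).2
    | mul a b _ _ ha hb =>
      obtain ⟨c, hc, hca⟩ := ha
      obtain ⟨d, hd, hdb⟩ := hb
      refine ⟨c * d, mul_nonneg hc hd, fun x => ?_⟩
      rw [mul_assoc, mul_assoc]
      exact (hca _).trans (mul_le_mul_of_nonneg_left (hdb x) hc)
  choose c hc using this
  exact ⟨c, fun g => (hc g).1, fun g => (hc g).2⟩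

open scoped Classical in
/-- The translates of the sets of a weighted Følner sequence protrude by a negligible weight. -/
theorem IsWeightedFolner.tendsto_sdiff {Γ : Type*} [Group Γ] {w : Γ → ℝ} (hw : ∀ x, 0 < w x)
    {F : ℕ → Finset Γ} (hF : IsWeightedFolner w F) (g : Γ) :
    Tendsto (fun n => (∑ x ∈ (F n).image (fun x => g * x) \ F n, w x) / ∑ x ∈ F n, w x)
      atTop (𝓝 0) := by
  rw [Metric.tendsto_atTop]
  intro ε hε
  obtain ⟨N, hN⟩ := hF.2 ε hε {g}
  refine ⟨N, fun n hn => ?_⟩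
  have h := hN n hn g (Finset.mem_singleton_self g)
  have hpos := weight_pos hw (hF.1 n)
  rw [← Finset.sdiff_union_self_eq_union, Finset.sum_union Finset.sdiff_disjoint, add_div,
    div_self hpos.ne'] at h
  rw [Real.dist_0_eq_abs, abs_of_nonneg (div_nonneg (Finset.sum_nonneg fun x _ => (hw x).le)
    hpos.le)]
  linarith

open scoped Classical in
/-- Most points of the sets of a weighted Følner sequence are not moved out of them. -/
theorem IsWeightedFolner.tendsto_exit {Γ : Type*} [Group Γ] {w : Γ → ℝ} (hw : ∀ x, 0 < w x)
    {F : ℕ → Finset Γ} (hF : IsWeightedFolner w F) {c : Γ → ℝ}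
    (hc : ∀ g x, w (g * x) ≤ c g * w x) (g : Γ) :
    Tendsto (fun n => (∑ x ∈ F n with g * x ∉ F n, w x) / ∑ x ∈ F n, w x) atTop (𝓝 0) := by
  have h0 := (hF.tendsto_sdiff hw g).const_mul (c g⁻¹)
  rw [mul_zero] at h0
  refine squeeze_zero (fun n => div_nonneg (Finset.sum_nonneg fun x _ => (hw x).le)
    (weight_pos hw (hF.1 n)).le) (fun n => ?_) h0
  rw [← mul_div_assoc]
  refine div_le_div_of_nonneg_right ?_ (weight_pos hw (hF.1 n)).le
  -- Translation by `g` carries the exiting points bijectively onto the protruding ones, so their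
  -- weights compare up to `c g⁻¹`.
  have himg : ((F n).filter fun x => g * x ∉ F n).image (fun x => g * x)
      = (F n).image (fun x => g * x) \ F n := by
    ext y
    simp only [Finset.mem_image, Finset.mem_filter, Finset.mem_sdiff]
    constructor
    · rintro ⟨x, ⟨h1, h2⟩, rfl⟩
      exact ⟨⟨x, h1, rfl⟩, h2⟩
    · rintro ⟨⟨x, h1, rfl⟩, h2⟩
      exact ⟨x, ⟨h1, h2⟩, rfl⟩
  rw [← himg, Finset.sum_image fun x _ y _ h => mul_left_cancel h, Finset.mul_sum]
  refine Finset.sum_le_sum fun x _ => ?_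
  simpa using hc g⁻¹ (g * x)

theorem ultrafilter_le_atTop {ω : Ultrafilter ℕ} (hω : ∀ n, ω ≠ pure n) :
    (ω : Filter ℕ) ≤ atTop := by
  rw [← Nat.cofinite_eq_atTop]
  exact ω.le_cofinite_or_eq_pure.resolve_right fun ⟨n, hn⟩ => hω n hn

/-- The mean is quasi-invariant under left translations. -/
theorem setMean_preimage_le {Γ : Type*} [Group Γ] {w : Γ → ℝ} (hw : ∀ x, 0 < w x)
    {F : ℕ → Finset Γ} (hF : IsWeightedFolner w F) {ω : Ultrafilter ℕ} (hω : ∀ n, ω ≠ pure n)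
    {c : Γ → ℝ} (hc0 : ∀ g, 0 ≤ c g) (hc : ∀ g x, w (g * x) ≤ c g * w x) (g : Γ) (A : Set Γ) :
    setMean w F ω ((fun x => g * x) ⁻¹' A) ≤ c g⁻¹ * setMean w F ω A := by
  classical
  -- The translate by `g` of the points of `F n` that it sends into `A` lies in `F n ∩ A`, up to the
  -- negligible part of `g F n` outside `F n`.
  have h0 := ((tendsto_setMean hw F ω A).add
    ((hF.tendsto_sdiff hw g).mono_left (ultrafilter_le_atTop hω))).const_mul (c g⁻¹)
  rw [add_zero] at h0
  refine le_of_tendsto_of_tendsto' (tendsto_setMean hw F ω _) h0 fun n => ?_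
  rw [← add_div, ← mul_div_assoc]
  refine div_le_div_of_nonneg_right ?_ (weight_pos hw (hF.1 n)).le
  calc ∑ x ∈ F n with x ∈ (fun x => g * x) ⁻¹' A, w x
      ≤ ∑ x ∈ F n with x ∈ (fun x => g * x) ⁻¹' A, c g⁻¹ * w (g * x) :=
        Finset.sum_le_sum fun x _ => by simpa using hc g⁻¹ (g * x)
    _ = c g⁻¹ * ∑ y ∈ ((F n).filter fun x => g * x ∈ A).image (fun x => g * x), w y := by
        rw [Finset.sum_image fun x _ y _ h => mul_left_cancel h, Finset.mul_sum]
        rfl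
    _ ≤ _ := by
        refine mul_le_mul_of_nonneg_left ?_ (hc0 _)
        rw [← Finset.sum_union]
        · refine Finset.sum_le_sum_of_subset_of_nonneg ?_ fun x _ _ => (hw x).le
          intro y hy
          simp only [Finset.mem_image, Finset.mem_filter, Finset.mem_union,
            Finset.mem_sdiff] at hy ⊢
          obtain ⟨x, ⟨h1, h2⟩, rfl⟩ := hy
          by_cases h : g * x ∈ F n
          · exact Or.inl ⟨h, h2⟩
          · exact Or.inr ⟨⟨x, h1, rfl⟩, h⟩
        · rw [Finset.disjoint_left]
          intro x hx hx'
          exact (Finset.mem_sdiff.1 hx').2 (Finset.mem_filter.1 hx).1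

/-- For a null set `B`, inner regularity reduces to a compact `K` with `g K ⊆ B`, and outer
regularity gives an open `U ⊇ B` of small measure. A basic clopen set fits between `g K` and `U`,
and there the inequality for the mean applies. -/
theorem quasiMeasurePreserving_smul {Γ : Type*} [Group Γ] {w : Γ → ℝ} (hw : ∀ x, 0 < w x)
    {F : ℕ → Finset Γ} (hF : IsWeightedFolner w F) {ω : Ultrafilter ℕ} (hω : ∀ n, ω ≠ pure n)
    {c : Γ → ℝ} (hc0 : ∀ g, 0 ≤ c g) (hc : ∀ g x, w (g * x) ≤ c g * w x) (g : Γ) :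
    Measure.QuasiMeasurePreserving (fun z : Ultrafilter Γ => g • z)
      (folnerMeasure w hw F ω) (folnerMeasure w hw F ω) := by
  have hcont := continuous_smul_ultrafilter g
  refine ⟨hcont.measurable, Measure.AbsolutelyContinuous.mk fun B hB hB0 => ?_⟩
  rw [Measure.map_apply hcont.measurable hB]
  have hBm := hcont.measurable hB
  rw [hBm.measure_eq_iSup_isCompact_of_ne_top (measure_ne_top _ _)]
  simp only [ENNReal.iSup_eq_zero]
  intro K hK hKc
  refine nonpos_iff_eq_zero.1 (le_of_forall_gt fun ε hε => ?_)
  obtain ⟨ε', hε', hε'ε⟩ : ∃ ε' : ENNReal, ε' ≠ 0 ∧ ENNReal.ofReal (c g⁻¹) * ε' < ε := by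
    obtain ⟨δ, h1, h2⟩ := ENNReal.exists_pos_mul_lt (ENNReal.ofReal_ne_top (r := c g⁻¹)) hε.ne'
    exact ⟨δ, h1.ne', by rwa [mul_comm]⟩
  obtain ⟨U, hBU, hUo, hU⟩ := Set.exists_isOpen_lt_of_lt B (μ := folnerMeasure w hw F ω) ε'
    (hB0 ▸ pos_iff_ne_zero.2 hε')
  obtain ⟨A, hA1, hA2⟩ := exists_basic_between (hKc.image hcont) hUo
    ((Set.image_subset_iff.2 hK).trans hBU)
  calc folnerMeasure w hw F ω K ≤ folnerMeasure w hw F ω {u | (fun x => g * x) ⁻¹' A ∈ u} :=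
        measure_mono fun u hu => hA1 (Set.mem_image_of_mem _ hu)
    _ ≤ ENNReal.ofReal (c g⁻¹) * folnerMeasure w hw F ω {u | A ∈ u} := by
        rw [folnerMeasure_basic, folnerMeasure_basic, ← ENNReal.ofReal_mul (hc0 _)]
        exact ENNReal.ofReal_le_ofReal (setMean_preimage_le hw hF hω hc0 hc g A)
    _ ≤ ENNReal.ofReal (c g⁻¹) * ε' := by
        gcongr
        exact (measure_mono hA2).trans hU.le
    _ < ε := hε'ε

end WeightedMean

/-! ### Partitions from separating sets -/

section BoundedPartitions

open scoped Classical in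
theorem sum_biUnion_le_of_nonneg {ι α : Type*} (s : Finset ι) (t : ι → Finset α) {f : α → ℝ}
    (hf : ∀ x, 0 ≤ f x) : ∑ x ∈ s.biUnion t, f x ≤ ∑ i ∈ s, ∑ x ∈ t i, f x := by
  induction s using Finset.induction_on with
  | empty => simp
  | insert a s ha ih =>
    rw [Finset.biUnion_insert, Finset.sum_insert ha]
    have := Finset.sum_union_inter (s₁ := t a) (s₂ := s.biUnion t) (f := f)
    have h0 : 0 ≤ ∑ x ∈ t a ∩ s.biUnion t, f x := Finset.sum_nonneg fun x _ => hf x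
    linarith

/-- Left translation by a fixed group element moves along a path in the Cayley graph that is
contained in a fixed finite neighbourhood. -/
theorem exists_finset_reachable {Γ : Type*} [Group Γ] {S : Finset Γ}
    (hS : Subgroup.closure (S : Set Γ) = ⊤) (g : Γ) :
    ∃ D : Finset Γ, ∀ (U : Set Γ) (x : Γ), (∀ d ∈ D, d * x ∈ U) →
      ∃ (hx : x ∈ U) (hy : g * x ∈ U),
        ((leftCayleyGraph S).induce U).Reachable ⟨x, hx⟩ ⟨g * x, hy⟩ := by
  classical
  have hs : ∀ s ∈ S, ∀ (U : Set Γ) (x : Γ) (hx : x ∈ U) (hy : s * x ∈ U),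
      ((leftCayleyGraph S).induce U).Reachable ⟨x, hx⟩ ⟨s * x, hy⟩ := by
    intro s hs U x hx hy
    by_cases h : x = s * x
    · have : (⟨x, hx⟩ : U) = ⟨s * x, hy⟩ := Subtype.ext h
      rw [← this]
    · have hadj : (leftCayleyGraph S).Adj x (s * x) :=
        (SimpleGraph.fromRel_adj _ _ _).2 ⟨h, Or.inl ⟨s, hs, rfl⟩⟩
      exact SimpleGraph.Adj.reachable (SimpleGraph.induce_adj.2 hadj)
  have hg : g ∈ Subgroup.closure (S : Set Γ) := hS ▸ Subgroup.mem_top g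
  induction hg using Subgroup.closure_induction'' with
  | one =>
    refine ⟨{1}, fun U x h => ?_⟩
    have hx : x ∈ U := by simpa using h
    refine ⟨hx, by simpa using hx, ?_⟩
    simp only [one_mul]
    exact SimpleGraph.Reachable.refl _
  | mem s hs' =>
    refine ⟨{1, s}, fun U x h => ?_⟩
    have hx : x ∈ U := by simpa using h 1 (by simp)
    exact ⟨hx, h s (by simp), hs s hs' U x hx _⟩
  | inv_mem s hs' =>
    refine ⟨{1, s⁻¹}, fun U x h => ?_⟩
    have hx : x ∈ U := by simpa using h 1 (by simp)
    have hy : s⁻¹ * x ∈ U := h s⁻¹ (by simp)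
    refine ⟨hx, hy, ?_⟩
    have := hs s hs' U (s⁻¹ * x) hy (by simpa using hx)
    simp only [mul_inv_cancel_left] at this
    exact this.symm
  | mul a b _ _ ha hb =>
    obtain ⟨D, hD⟩ := ha
    obtain ⟨E, hE⟩ := hb
    refine ⟨E ∪ D.image (fun d => d * b), fun U x h => ?_⟩
    obtain ⟨h1, h2, h3⟩ := hE U x fun d hd => h d (Finset.mem_union_left _ hd)
    obtain ⟨h4, h5, h6⟩ := hD U (b * x) fun d hd => by
      rw [← mul_assoc]
      exact h _ (Finset.mem_union_right _ (Finset.mem_image_of_mem _ hd))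
    refine ⟨h1, by rwa [mul_assoc], ?_⟩
    simp only [mul_assoc]
    exact h3.trans h6

open scoped Pointwise Classical in
/-- Points joined by a walk in the Cayley graph differ by a word of bounded length. -/
theorem mul_inv_mem_pow_of_walk {Γ : Type*} [Group Γ] {S : Finset Γ} {U : Set Γ} {x y : U}
    (p : ((leftCayleyGraph S).induce U).Walk x y) :
    (y : Γ) * (x : Γ)⁻¹ ∈ (S ∪ S⁻¹) ^ p.length := by
  induction p with
  | nil => simp
  | @cons u v z h p ih =>
    rw [SimpleGraph.Walk.length_cons, pow_succ]
    have : (z : Γ) * (u : Γ)⁻¹ = (z * (v : Γ)⁻¹) * (v * (u : Γ)⁻¹) := by group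
    rw [this]
    refine Finset.mul_mem_mul ih ?_
    obtain ⟨-, ⟨s, hs, h⟩ | ⟨s, hs, h⟩⟩ :=
      (SimpleGraph.fromRel_adj _ _ _).1 (SimpleGraph.induce_adj.1 h)
    · rw [h, mul_inv_cancel_right]
      exact Finset.mem_union_left _ hs
    · rw [h, mul_inv_rev, mul_inv_cancel_left]
      exact Finset.mem_union_right _ (Finset.inv_mem_inv hs)

/-- The partition of a set into the connected components of an induced subgraph, with singletons
outside of it. -/
def componentSetoid {V : Type*} (G : SimpleGraph V) (U : Set V) : Setoid V where
  r x y := x = y ∨ ∃ (hx : x ∈ U) (hy : y ∈ U), (G.induce U).Reachable ⟨x, hx⟩ ⟨y, hy⟩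
  iseqv :=
    { refl := fun _ => Or.inl rfl
      symm := by
        rintro x y (h | ⟨hx, hy, h⟩)
        · exact Or.inl h.symm
        · exact Or.inr ⟨hy, hx, h.symm⟩
      trans := by
        rintro x y z (rfl | ⟨hx, hy, h⟩) h'
        · exact h'
        · rcases h' with rfl | ⟨hy', hz, h'⟩
          · exact Or.inr ⟨hx, hy, h⟩
          · exact Or.inr ⟨hx, hz, h.trans h'⟩ }

open scoped Pointwise Classical in
/-- In a weighted hyperfinite group, for every weight on a finite set there is a partition with
classes of uniformly bounded size for which most points stay in their class under given
translations. -/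
theorem IsWeightedHyperfiniteGroup.exists_setoid {Γ : Type*} [Group Γ]
    (hΓ : IsWeightedHyperfiniteGroup Γ) (L : Finset Γ) {ε : ℝ} (hε : 0 < ε) :
    ∃ Q : Finset Γ, ∀ (V : Finset Γ) (v : Γ → ℝ), (∀ x, 0 ≤ v x) →
      ∃ r : Setoid Γ, (∀ x y, r x y → y * x⁻¹ ∈ Q) ∧
        ∑ x ∈ V with ∃ g ∈ L, ¬ r x (g * x), v x ≤ ε * ∑ x ∈ V, v x := by
  obtain ⟨S, hS, hyp⟩ := hΓ
  choose D hD using exists_finset_reachable hS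
  set E := L.biUnion D with hE
  -- Each point of `V` will be counted at most `E.card` times in the auxiliary weight; the `+ 1`
  -- keeps the denominator positive.
  obtain ⟨K, hK⟩ := hyp (ε / (E.card + 1)) (by positivity)
  -- A path in a component with at most `K` vertices has length less than `K`; `1` accounts for the
  -- singleton classes.
  refine ⟨insert 1 ((Finset.range K).biUnion fun n => (S ∪ S⁻¹) ^ n),
    fun V v hv => ?_⟩
  -- `v'` places a copy of the weight of each `x ∈ V` at every `d * x`, `d ∈ E`. Thus a separating
  -- set `M` that is light for `v'` meets `E * x` only for few `x`; every other `x` keeps its path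
  -- to `g * x`.
  set V' := E.biUnion fun d => V.image fun x => d * x with hV'
  set v' : Γ → ℝ := fun y => ∑ d ∈ E, if d⁻¹ * y ∈ V then v (d⁻¹ * y) else 0 with hv'
  have hmass : ∀ T : Finset Γ, ∑ y ∈ T, v' y = ∑ d ∈ E, ∑ x ∈ V with d * x ∈ T, v x := by
    intro T
    rw [hv', Finset.sum_comm]
    refine Finset.sum_congr rfl fun d _ => ?_
    rw [← Finset.sum_filter]
    refine Finset.sum_nbij' (fun y => d⁻¹ * y) (fun x => d * x) ?_ ?_ ?_ ?_ ?_ <;> simp +contextual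
  obtain ⟨M, hMV, hMw, hMc⟩ := hK V' v' fun x _ => Finset.sum_nonneg fun d _ => by
    split_ifs
    · exact hv _
    · exact le_rfl
  refine ⟨componentSetoid (leftCayleyGraph S) ((V' : Set Γ) \ M), ?_, ?_⟩
  · rintro x y (rfl | ⟨hx, hy, hr⟩)
    · simp
    · refine Finset.mem_insert_of_mem (Finset.mem_biUnion.2 ?_)
      obtain ⟨p, hp⟩ := hr.exists_isPath
      refine ⟨p.length, Finset.mem_range.2 ?_, mul_inv_mem_pow_of_walk p⟩
      have hfin : Finite ((V' : Set Γ) \ M : Set Γ) := (V'.finite_toSet.sdiff).to_subtype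
      refine lt_of_lt_of_le ?_ (hMc (SimpleGraph.connectedComponentMk _ ⟨x, hx⟩))
      rw [← Nat.succ_le_iff, Nat.succ_eq_add_one, ← SimpleGraph.Walk.length_support,
        ← List.toFinset_card_of_nodup hp.support_nodup, ← Set.ncard_coe_finset]
      refine Set.ncard_le_ncard (fun z hz => ?_) (Set.toFinite _)
      rw [SimpleGraph.ConnectedComponent.mem_supp_iff, SimpleGraph.ConnectedComponent.eq]
      rw [Finset.mem_coe, List.mem_toFinset] at hz
      exact (p.takeUntil z hz).reachable.symm
  · calc ∑ x ∈ V with ∃ g ∈ L, ¬ componentSetoid (leftCayleyGraph S) ((V' : Set Γ) \ M) x (g * x),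
          v x ≤ ∑ x ∈ E.biUnion (fun d => V.filter fun x => d * x ∈ M), v x := by
          refine Finset.sum_le_sum_of_subset_of_nonneg ?_ fun x _ _ => hv x
          intro x hx
          obtain ⟨hxV, g, hg, hgx⟩ := Finset.mem_filter.1 hx
          by_contra hcon
          refine hgx (Or.inr (hD g _ x fun d hd => ?_))
          have hdE : d ∈ E := Finset.mem_biUnion.2 ⟨g, hg, hd⟩
          refine ⟨Finset.mem_biUnion.2 ⟨d, hdE, Finset.mem_image_of_mem _ hxV⟩, fun hdM => ?_⟩
          exact hcon (Finset.mem_biUnion.2 ⟨d, hdE, Finset.mem_filter.2 ⟨hxV, hdM⟩⟩)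
      _ ≤ ∑ d ∈ E, ∑ x ∈ V with d * x ∈ M, v x := sum_biUnion_le_of_nonneg _ _ hv
      _ = ∑ y ∈ M, v' y := (hmass M).symm
      _ ≤ ε / (E.card + 1) * ∑ y ∈ V', v' y := hMw
      _ ≤ ε / (E.card + 1) * (E.card * ∑ x ∈ V, v x) := by
          gcongr
          rw [hmass, ← nsmul_eq_mul]
          exact Finset.sum_le_card_nsmul _ _ _ fun d _ =>
            Finset.sum_le_sum_of_subset_of_nonneg (Finset.filter_subset _ _) fun x _ _ => hv x
      _ ≤ ε * ∑ x ∈ V, v x := by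
          have h0 : 0 ≤ ∑ x ∈ V, v x := Finset.sum_nonneg fun x _ => hv x
          rw [← mul_assoc]
          refine mul_le_mul_of_nonneg_right ?_ h0
          rw [div_mul_eq_mul_div, div_le_iff₀ (by positivity)]
          nlinarith

end BoundedPartitions

/-! ### Tiles with small relative boundary -/

section Tiles

open scoped Pointwise Classical

/-- The points of `A` that some element of `L` moves within `A` into or out of `T`. -/
noncomputable def tileBoundary {Γ : Type*} [Group Γ] (A : Set Γ) (L T : Finset Γ) : Finset Γ :=
  {y ∈ T ∪ L⁻¹ * T | y ∈ A ∧ ∃ g ∈ L, g * y ∈ A ∧ ¬ (y ∈ T ↔ g * y ∈ T)}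

/-- A finite subset of `A` with small boundary relative to `A`. -/
def IsGoodTile {Γ : Type*} [Group Γ] (w : Γ → ℝ) (A : Set Γ) (L : Finset Γ) (ε : ℝ)
    (T : Finset Γ) : Prop :=
  (T : Set Γ) ⊆ A ∧ ∑ y ∈ tileBoundary A L T, w y ≤ ε * ∑ y ∈ T, w y

/-- The ambient set `T ∪ L⁻¹ * T` serves only to make the boundary a finite set; every point with
the defining property lies in it. -/
theorem mem_tileBoundary {Γ : Type*} [Group Γ] {A : Set Γ} {L T : Finset Γ} {y : Γ} :
    y ∈ tileBoundary A L T ↔ y ∈ A ∧ ∃ g ∈ L, g * y ∈ A ∧ ¬ (y ∈ T ↔ g * y ∈ T) := by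
  refine ⟨fun h => (Finset.mem_filter.1 h).2, fun h => Finset.mem_filter.2 ⟨?_, h⟩⟩
  obtain ⟨-, g, hg, -, hgT⟩ := h
  by_cases hy : y ∈ T
  · exact Finset.mem_union_left _ hy
  · refine Finset.mem_union_right _ ?_
    have hgy : g * y ∈ T := by tauto
    simpa using Finset.mul_mem_mul (Finset.inv_mem_inv hg) hgy

/-- The members of one class share a unit in proportion to their weights. This bounds the charge on
each separated point in the double count below. -/
theorem sum_div_class_le_one {Γ : Type*} {w : Γ → ℝ} (hw : ∀ x, 0 < w x) (A : Finset Γ)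
    (r : Setoid Γ) (u : Γ) :
    ∑ x ∈ A with u ∈ A ∧ r x u, w x / ∑ y ∈ A with r x y, w y ≤ 1 := by
  by_cases hu : u ∈ A
  · have h1 : ∀ x ∈ A.filter (fun x => u ∈ A ∧ r x u),
        w x / ∑ y ∈ A with r x y, w y = w x / ∑ y ∈ A with r u y, w y := by
      intro x hx
      have hxu := (Finset.mem_filter.1 hx).2.2
      congr 2
      ext y
      simp only [Finset.mem_filter, and_congr_right_iff]
      exact fun _ => ⟨fun h => r.trans (r.symm hxu) h, fun h => r.trans hxu h⟩
    rw [Finset.sum_congr rfl h1, ← Finset.sum_div]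
    refine div_le_one_of_le₀ ?_ (Finset.sum_nonneg fun x _ => (hw x).le)
    refine Finset.sum_le_sum_of_subset_of_nonneg (fun x hx => ?_) fun x _ _ => (hw x).le
    obtain ⟨h2, -, h3⟩ := Finset.mem_filter.1 hx
    exact Finset.mem_filter.2 ⟨h2, r.symm h3⟩
  · simp [hu]

/-- If a partition separates few points from their translates, then most points lie in classes
with small boundary. -/
theorem sum_le_two_mul_sum_goodTile {Γ : Type*} [Group Γ] {w : Γ → ℝ} (hw : ∀ x, 0 < w x)
    (A L : Finset Γ) (r : Setoid Γ) {ε δ : ℝ} (hε : 0 < ε) (hδ : 2 * (δ * (L.card + 1)) ≤ ε)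
    (hr : ∑ x ∈ A with ∃ g ∈ L, ¬ r x (g * x), w x ≤ δ * ∑ x ∈ A, w x) :
    ∑ x ∈ A, w x ≤ 2 * ∑ x ∈ A with IsGoodTile w (A : Set Γ) L ε {y ∈ A | r x y}, w x := by
  set W : Γ → ℝ := fun x => ∑ y ∈ A with r x y, w y with hW
  set X := A.filter fun x => ∃ g ∈ L, ¬ r x (g * x) with hX
  have hWpos : ∀ x ∈ A, 0 < W x := fun x hx =>
    weight_pos hw ⟨x, Finset.mem_filter.2 ⟨hx, r.refl x⟩⟩
  -- A boundary point of a class is separated from a translate, and it lies in the class (the term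
  -- `g = 1`) or is moved into it by some `g ∈ L`.
  have hbd : ∀ x ∈ A, ∑ y ∈ tileBoundary (A : Set Γ) L {y ∈ A | r x y}, w y ≤
      ∑ y ∈ X, ∑ g ∈ insert 1 L, if g * y ∈ A ∧ r x (g * y) then w y else 0 := by
    intro x hx
    have hsub : tileBoundary (A : Set Γ) L {y ∈ A | r x y} ⊆ X := by
      intro y hy
      obtain ⟨hyA, g, hg, hgA, hiff⟩ := mem_tileBoundary.1 hy
      refine Finset.mem_filter.2 ⟨hyA, g, hg, fun h => hiff ?_⟩
      simp only [Finset.mem_filter]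
      exact ⟨fun h' => ⟨hgA, r.trans h'.2 h⟩, fun h' => ⟨hyA, r.trans h'.2 (r.symm h)⟩⟩
    refine (Finset.sum_le_sum fun y hy => ?_).trans
      (Finset.sum_le_sum_of_subset_of_nonneg hsub fun y _ _ => Finset.sum_nonneg fun g _ => ?_)
    · obtain ⟨hyA, g, hg, hgA, hiff⟩ := mem_tileBoundary.1 hy
      obtain ⟨g', hg', hgg⟩ : ∃ g' ∈ insert 1 L, g' * y ∈ A ∧ r x (g' * y) := by
        by_cases h : r x y
        · exact ⟨1, Finset.mem_insert_self _ _, by simpa using hyA, by simpa using h⟩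
        · refine ⟨g, Finset.mem_insert_of_mem hg, hgA, ?_⟩
          by_contra h'
          exact hiff (by simp [h, h'])
      calc w y = if g' * y ∈ A ∧ r x (g' * y) then w y else 0 := (if_pos hgg).symm
        _ ≤ _ := Finset.single_le_sum
          (f := fun g => if g * y ∈ A ∧ r x (g * y) then w y else 0)
          (fun g _ => by split_ifs; exacts [(hw y).le, le_rfl]) hg'
    · split_ifs
      exacts [(hw y).le, le_rfl]
  -- Double counting: the boundary of a bad class, heavier than `ε` times the class, is distributed
  -- over its members in proportion to weight. Each separated `y` is charged at most once for its
  -- own class and once for that of each `g * y`, hence the factor `L.card + 1`.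
  have hbad : ε * ∑ x ∈ A with ¬ IsGoodTile w (A : Set Γ) L ε {y ∈ A | r x y}, w x
      ≤ δ * (L.card + 1) * ∑ x ∈ A, w x := by
    calc ε * ∑ x ∈ A with ¬ IsGoodTile w (A : Set Γ) L ε {y ∈ A | r x y}, w x
        ≤ ∑ x ∈ A with ¬ IsGoodTile w (A : Set Γ) L ε {y ∈ A | r x y}, w x / W x *
            ∑ y ∈ X, ∑ g ∈ insert 1 L, if g * y ∈ A ∧ r x (g * y) then w y else 0 := by
          rw [Finset.mul_sum]
          refine Finset.sum_le_sum fun x hx => ?_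
          obtain ⟨hxA, hx⟩ := Finset.mem_filter.1 hx
          have h1 : ε * W x < ∑ y ∈ tileBoundary (A : Set Γ) L {y ∈ A | r x y}, w y := by
            by_contra h
            exact hx ⟨fun y hy => (Finset.mem_filter.1 hy).1, not_lt.1 h⟩
          have h2 := h1.le.trans (hbd x hxA)
          calc ε * w x = w x / W x * (ε * W x) := by
                field_simp [(hWpos x hxA).ne']
            _ ≤ _ := mul_le_mul_of_nonneg_left h2 (div_nonneg (hw x).le (hWpos x hxA).le)
      _ ≤ ∑ x ∈ A, w x / W x *
            ∑ y ∈ X, ∑ g ∈ insert 1 L, if g * y ∈ A ∧ r x (g * y) then w y else 0 := by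
          refine Finset.sum_le_sum_of_subset_of_nonneg (Finset.filter_subset _ _) fun x hx _ => ?_
          refine mul_nonneg (div_nonneg (hw x).le (hWpos x hx).le) ?_
          refine Finset.sum_nonneg fun y _ => Finset.sum_nonneg fun g _ => ?_
          split_ifs
          exacts [(hw y).le, le_rfl]
      _ = ∑ y ∈ X, ∑ g ∈ insert 1 L, w y * ∑ x ∈ A with g * y ∈ A ∧ r x (g * y), w x / W x := by
          simp_rw [Finset.mul_sum]
          rw [Finset.sum_comm]
          refine Finset.sum_congr rfl fun y _ => ?_
          rw [Finset.sum_comm]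
          refine Finset.sum_congr rfl fun g _ => ?_
          rw [Finset.sum_filter]
          refine Finset.sum_congr rfl fun x _ => ?_
          split_ifs
          · exact mul_comm _ _
          · simp
      _ ≤ ∑ y ∈ X, ∑ g ∈ insert 1 L, w y := by
          refine Finset.sum_le_sum fun y _ => Finset.sum_le_sum fun g _ => ?_
          exact mul_le_of_le_one_right (hw y).le (sum_div_class_le_one hw A r (g * y))
      _ ≤ (L.card + 1) * ∑ y ∈ X, w y := by
          simp only [Finset.sum_const, nsmul_eq_mul]
          rw [← Finset.mul_sum]
          refine mul_le_mul_of_nonneg_right ?_ (Finset.sum_nonneg fun x _ => (hw x).le)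
          exact_mod_cast Finset.card_insert_le 1 L
      _ ≤ (L.card + 1) * (δ * ∑ x ∈ A, w x) := by gcongr
      _ = δ * (L.card + 1) * ∑ x ∈ A, w x := by ring
  have hsplit := Finset.sum_filter_add_sum_filter_not A
    (fun x => IsGoodTile w (A : Set Γ) L ε {y ∈ A | r x y}) w
  have h0 : 0 ≤ ∑ x ∈ A, w x := Finset.sum_nonneg fun x _ => (hw x).le
  have h1 : 2 * (δ * (L.card + 1) * ∑ x ∈ A, w x) ≤ ε * ∑ x ∈ A, w x := by
    rw [← mul_assoc]
    exact mul_le_mul_of_nonneg_right hδ h0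
  have h2 : ε * (2 * ∑ x ∈ A with ¬ IsGoodTile w (A : Set Γ) L ε {y ∈ A | r x y}, w x)
      ≤ ε * ∑ x ∈ A, w x := by linarith
  have h3 := le_of_mul_le_mul_left h2 hε
  linarith

/-- In every set, the tiles of some bounded shape with small boundary occupy a definite part. -/
theorem exists_tile_shape {Γ : Type*} [Group Γ] {w : Γ → ℝ} (hw : ∀ x, 0 < w x)
    {F : ℕ → Finset Γ} (hF : IsWeightedFolner w F) {ω : Ultrafilter ℕ} (hω : ∀ n, ω ≠ pure n)
    {c : Γ → ℝ} (hc : ∀ g x, w (g * x) ≤ c g * w x)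
    {L Q : Finset Γ} {ε δ : ℝ} (hε : 0 < ε) (hδ : 2 * (δ * (L.card + 1)) ≤ ε)
    (hQ : ∀ V : Finset Γ, ∃ r : Setoid Γ, (∀ x y, r x y → y * x⁻¹ ∈ Q) ∧
      ∑ x ∈ V with ∃ g ∈ L, ¬ r x (g * x), w x ≤ δ * ∑ x ∈ V, w x) (A : Set Γ) :
    ∃ B ⊆ Q, 1 ∈ B ∧ setMean w F ω A ≤ 2 * (2 ^ Q.card *
      setMean w F ω {x | IsGoodTile w A L ε (B.image fun b => b * x)}) := by
  set Z : Finset Γ → Set Γ := fun B => {x | IsGoodTile w A L ε (B.image fun b => b * x)} with hZ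
  set P := Q.powerset.filter fun B => 1 ∈ B with hP
  -- If `D * x ⊆ F n`, all `L`-neighbours of the tile of `x` lie in `F n`, so its boundary relative
  -- to `A` is no larger than that relative to `A ∩ F n`. The remaining `x` have negligible weight.
  set D := (L ∪ L⁻¹) * Q with hD
  have hone : (1 : Γ) ∈ Q := by
    obtain ⟨r, hr, -⟩ := hQ ∅
    simpa using hr 1 1 (r.refl 1)
  have hPne : P.Nonempty := ⟨Q, Finset.mem_filter.2 ⟨Finset.mem_powerset_self Q, hone⟩⟩
  have hsum : setMean w F ω A ≤ 2 * ∑ B ∈ P, setMean w F ω (Z B) := by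
    have hlim : Tendsto (fun n => 2 * (∑ B ∈ P, (∑ x ∈ F n with x ∈ Z B, w x) / ∑ x ∈ F n, w x +
        ∑ d ∈ D, (∑ x ∈ F n with d * x ∉ F n, w x) / ∑ x ∈ F n, w x)) ω
        (𝓝 (2 * (∑ B ∈ P, setMean w F ω (Z B) + ∑ d ∈ D, 0))) :=
      ((tendsto_finsetSum _ fun B _ => tendsto_setMean hw F ω (Z B)).add
        (tendsto_finsetSum _ fun d _ =>
          (hF.tendsto_exit hw hc d).mono_left (ultrafilter_le_atTop hω))).const_mul 2
    rw [Finset.sum_const_zero, add_zero] at hlim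
    refine le_of_tendsto_of_tendsto' (tendsto_setMean hw F ω A) hlim fun n => ?_
    rw [← Finset.sum_div, ← Finset.sum_div, ← add_div, ← mul_div_assoc]
    refine div_le_div_of_nonneg_right ?_ (weight_pos hw (hF.1 n)).le
    obtain ⟨r, hrQ, hr⟩ := hQ ((F n).filter fun x => x ∈ A)
    refine (sum_le_two_mul_sum_goodTile hw _ L r hε hδ hr).trans ?_
    refine mul_le_mul_of_nonneg_left ?_ zero_le_two
    set An := (F n).filter fun x => x ∈ A with hAn
    calc ∑ x ∈ An with IsGoodTile w (An : Set Γ) L ε {y ∈ An | r x y}, w x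
        ≤ ∑ x ∈ (P.biUnion fun B => (F n).filter fun x => x ∈ Z B) ∪
            D.biUnion fun d => (F n).filter fun x => d * x ∉ F n, w x := by
          refine Finset.sum_le_sum_of_subset_of_nonneg (fun x hx => ?_) fun x _ _ => (hw x).le
          obtain ⟨hxA, hgood⟩ := Finset.mem_filter.1 hx
          have hxF := (Finset.mem_filter.1 hxA).1
          by_cases hxD : ∃ d ∈ D, d * x ∉ F n
          · obtain ⟨d, hd, hdx⟩ := hxD
            exact Finset.mem_union_right _ (Finset.mem_biUnion.2
              ⟨d, hd, Finset.mem_filter.2 ⟨hxF, hdx⟩⟩)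
          push Not at hxD
          -- The shape is the class of `x` translated back by `x⁻¹`.
          refine Finset.mem_union_left _ (Finset.mem_biUnion.2
            ⟨Q.filter fun h => h * x ∈ An ∧ r x (h * x), ?_, Finset.mem_filter.2 ⟨hxF, ?_⟩⟩)
          · refine Finset.mem_filter.2 ⟨Finset.mem_powerset.2 (Finset.filter_subset _ _),
              Finset.mem_filter.2 ⟨hone, ?_⟩⟩
            rw [one_mul]
            exact ⟨hxA, r.refl x⟩
          · have himg : (Q.filter fun h => h * x ∈ An ∧ r x (h * x)).image (fun b => b * x)
                = {y ∈ An | r x y} := by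
              ext y
              simp only [Finset.mem_image, Finset.mem_filter]
              constructor
              · rintro ⟨h, ⟨-, h2⟩, rfl⟩
                exact h2
              · intro h
                refine ⟨y * x⁻¹, ⟨hrQ x y h.2, ?_⟩, by group⟩
                rwa [inv_mul_cancel_right]
            change IsGoodTile w A L ε _
            rw [himg]
            refine ⟨fun y hy => (Finset.mem_filter.1 (Finset.mem_filter.1 hy).1).2,
              (Finset.sum_le_sum_of_subset_of_nonneg ?_ fun x _ _ => (hw x).le).trans hgood.2⟩
            intro y hy
            obtain ⟨hyA, g, hg, hgA, hiff⟩ := mem_tileBoundary.1 hy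
            have key : ∀ u ∈ An.filter (fun y => r x y), ∀ h ∈ L ∪ L⁻¹, h * u ∈ F n := by
              intro u hu h hh
              have := hxD (h * (u * x⁻¹)) (Finset.mul_mem_mul hh
                (hrQ x u (Finset.mem_filter.1 hu).2))
              rwa [mul_assoc, inv_mul_cancel_right] at this
            have hmem : y ∈ F n ∧ g * y ∈ F n := by
              by_cases hyT : y ∈ An.filter fun y => r x y
              · exact ⟨(Finset.mem_filter.1 (Finset.mem_filter.1 hyT).1).1,
                  key y hyT g (Finset.mem_union_left _ hg)⟩
              · have hgT : g * y ∈ An.filter fun y => r x y := by tauto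
                refine ⟨?_, (Finset.mem_filter.1 (Finset.mem_filter.1 hgT).1).1⟩
                simpa using key _ hgT g⁻¹ (Finset.mem_union_right _ (Finset.inv_mem_inv hg))
            refine mem_tileBoundary.2 ⟨?_, g, hg, ?_, hiff⟩
            · exact Finset.mem_coe.2 (Finset.mem_filter.2 ⟨hmem.1, hyA⟩)
            · exact Finset.mem_coe.2 (Finset.mem_filter.2 ⟨hmem.2, hgA⟩)
      _ ≤ _ := by
          have h1 := Finset.sum_union_inter (f := w)
            (s₁ := P.biUnion fun B => (F n).filter fun x => x ∈ Z B)
            (s₂ := D.biUnion fun d => (F n).filter fun x => d * x ∉ F n)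
          have h2 : 0 ≤ ∑ x ∈ (P.biUnion fun B => (F n).filter fun x => x ∈ Z B) ∩
            D.biUnion fun d => (F n).filter fun x => d * x ∉ F n, w x :=
            Finset.sum_nonneg fun x _ => (hw x).le
          have h3 := sum_biUnion_le_of_nonneg P (fun B => (F n).filter fun x => x ∈ Z B)
            fun x => (hw x).le
          have h4 := sum_biUnion_le_of_nonneg D (fun d => (F n).filter fun x => d * x ∉ F n)
            fun x => (hw x).le
          linarith
  -- Pigeonhole over at most `2 ^ Q.card` shapes. It comes after the limit, so the shape does not
  -- depend on `n` although the partitions did.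
  obtain ⟨B, hB, hmax⟩ := P.exists_max_image (fun B => setMean w F ω (Z B)) hPne
  refine ⟨B, Finset.mem_powerset.1 (Finset.mem_filter.1 hB).1, (Finset.mem_filter.1 hB).2,
    hsum.trans ?_⟩
  refine mul_le_mul_of_nonneg_left ((Finset.sum_le_card_nsmul _ _ _ hmax).trans ?_) zero_le_two
  rw [nsmul_eq_mul]
  refine mul_le_mul_of_nonneg_right ?_ (setMean_nonneg hw F ω _)
  have : P.card ≤ 2 ^ Q.card :=
    (Finset.card_filter_le _ _).trans (Finset.card_powerset Q).le
  exact_mod_cast this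

end Tiles

/-! ### Exhausting the group by disjoint tiles -/

section Exhaustion

open scoped Pointwise Classical

/-- A centre whose tile met no chosen tile could be added to a maximal family. `1 ∈ B` makes tiles
nonempty, so that a chosen tile meets itself. -/
theorem exists_maximal_disjoint_tiles {Γ : Type*} [Group Γ] (B : Finset Γ) (hB : 1 ∈ B)
    (Z : Set Γ) :
    ∃ Z' ⊆ Z, (∀ z ∈ Z', ∀ z' ∈ Z', ∀ y ∈ B.image (fun b => b * z),
        y ∈ B.image (fun b => b * z') → z = z') ∧
      ∀ x ∈ Z, ∃ b ∈ B, ∃ z ∈ Z', b * x ∈ B.image fun b => b * z := by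
  obtain ⟨Z', hZ'⟩ := zorn_subset {Z' : Set Γ | Z' ⊆ Z ∧ ∀ z ∈ Z', ∀ z' ∈ Z',
      ∀ y ∈ B.image (fun b => b * z), y ∈ B.image (fun b => b * z') → z = z'} (by
    intro c hc hchain
    refine ⟨⋃₀ c, ⟨Set.sUnion_subset fun s hs => (hc hs).1, ?_⟩,
      fun s hs => Set.subset_sUnion_of_mem hs⟩
    rintro x ⟨s, hs, hxs⟩ y ⟨t, ht, hyt⟩
    rcases hchain.total hs ht with h | h
    · exact (hc ht).2 x (h hxs) y hyt
    · exact (hc hs).2 x hxs y (h hyt))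
  refine ⟨Z', hZ'.1.1, hZ'.1.2, fun x hx => ?_⟩
  by_contra! hcon
  have hxZ' : x ∈ Z' := by
    refine hZ'.2 (y := insert x Z') ⟨Set.insert_subset hx hZ'.1.1, ?_⟩ (Set.subset_insert _ _)
      (Set.mem_insert _ _)
    rintro z (rfl | hz) z' (rfl | hz') y hy hy'
    · rfl
    · obtain ⟨b, hb, rfl⟩ := Finset.mem_image.1 hy
      exact (hcon b hb z' hz' hy').elim
    · obtain ⟨b, hb, rfl⟩ := Finset.mem_image.1 hy'
      exact (hcon b hb z hz hy).elim
    · exact hZ'.1.2 z hz z' hz' y hy hy'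
  exact hcon 1 hB x hxZ' (Finset.mem_image.2 ⟨1, hB, rfl⟩)

/-- The boundary of a disjoint family of good tiles of the same shape is small compared to their
union. -/
theorem setMean_tileBoundary_le {Γ : Type*} [Group Γ] {w : Γ → ℝ} (hw : ∀ x, 0 < w x)
    {F : ℕ → Finset Γ} (hF : IsWeightedFolner w F) {ω : Ultrafilter ℕ} (hω : ∀ n, ω ≠ pure n)
    {A Z : Set Γ} {L B : Finset Γ} {ε : ℝ} (hε : 0 < ε)
    (hZ : ∀ z ∈ Z, IsGoodTile w A L ε (B.image fun b => b * z))
    (hdisj : ∀ z ∈ Z, ∀ z' ∈ Z, ∀ y ∈ B.image (fun b => b * z),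
        y ∈ B.image (fun b => b * z') → z = z') :
    setMean w F ω {x | ∃ z ∈ Z, x ∈ tileBoundary A L (B.image fun b => b * z)} ≤
      ε * setMean w F ω {x | ∃ z ∈ Z, x ∈ B.image fun b => b * z} := by
  set T : Γ → Finset Γ := fun z => B.image fun b => b * z with hT
  set Y : Set Γ := {x | ∃ z ∈ Z, x ∈ T z} with hY
  -- Tiles with a boundary point in `F n` have centres in `B⁻¹ * insert 1 L * F n`, so they lie in
  -- `D * F n`; what protrudes from `F n` is negligible.
  set D := B * (B⁻¹ * insert 1 L) with hD
  have hlim := ((tendsto_setMean hw F ω Y).add (tendsto_finsetSum D fun d _ =>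
      (hF.tendsto_sdiff hw d).mono_left (ultrafilter_le_atTop hω))).const_mul ε
  rw [Finset.sum_const_zero, add_zero] at hlim
  refine le_of_tendsto_of_tendsto' (tendsto_setMean hw F ω _) hlim fun n => ?_
  rw [← Finset.sum_div, ← add_div, ← mul_div_assoc]
  refine div_le_div_of_nonneg_right ?_ (weight_pos hw (hF.1 n)).le
  set Zn := (B⁻¹ * insert 1 L * F n).filter fun z => z ∈ Z with hZn
  calc ∑ x ∈ F n with x ∈ {x | ∃ z ∈ Z, x ∈ tileBoundary A L (T z)}, w x
      ≤ ∑ x ∈ Zn.biUnion fun z => tileBoundary A L (T z), w x := by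
        refine Finset.sum_le_sum_of_subset_of_nonneg (fun x hx => ?_) fun x _ _ => (hw x).le
        obtain ⟨hxF, z, hz, hxz⟩ := Finset.mem_filter.1 hx
        refine Finset.mem_biUnion.2 ⟨z, Finset.mem_filter.2 ⟨?_, hz⟩, hxz⟩
        obtain ⟨g, hg, hgT⟩ : ∃ g ∈ insert 1 L, g * x ∈ T z := by
          obtain ⟨-, g, hg, -, hiff⟩ := mem_tileBoundary.1 hxz
          by_cases h : x ∈ T z
          · exact ⟨1, Finset.mem_insert_self _ _, by rwa [one_mul]⟩
          · exact ⟨g, Finset.mem_insert_of_mem hg, by tauto⟩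
        obtain ⟨b, hb, hbz⟩ := Finset.mem_image.1 hgT
        have : z = b⁻¹ * g * x := by rw [mul_assoc, ← hbz, inv_mul_cancel_left]
        rw [this]
        exact Finset.mul_mem_mul (Finset.mul_mem_mul (Finset.inv_mem_inv hb) hg) hxF
    _ ≤ ∑ z ∈ Zn, ∑ x ∈ tileBoundary A L (T z), w x :=
        sum_biUnion_le_of_nonneg _ _ fun x => (hw x).le
    _ ≤ ∑ z ∈ Zn, ε * ∑ x ∈ T z, w x :=
        Finset.sum_le_sum fun z hz => (hZ z (Finset.mem_filter.1 hz).2).2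
    _ = ε * ∑ x ∈ Zn.biUnion T, w x := by
        rw [← Finset.mul_sum, Finset.sum_biUnion]
        intro z hz z' hz' hne
        refine Finset.disjoint_left.2 fun y hy hy' => hne ?_
        exact hdisj z (Finset.mem_filter.1 hz).2 z' (Finset.mem_filter.1 hz').2 y hy hy'
    _ ≤ ε * ∑ x ∈ ((F n).filter fun x => x ∈ Y) ∪
          D.biUnion fun d => (F n).image (fun x => d * x) \ F n, w x := by
        refine mul_le_mul_of_nonneg_left ?_ hε.le
        refine Finset.sum_le_sum_of_subset_of_nonneg (fun y hy => ?_) fun x _ _ => (hw x).le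
        obtain ⟨z, hz, hyz⟩ := Finset.mem_biUnion.1 hy
        obtain ⟨hz1, hz2⟩ := Finset.mem_filter.1 hz
        by_cases hyF : y ∈ F n
        · exact Finset.mem_union_left _ (Finset.mem_filter.2 ⟨hyF, z, hz2, hyz⟩)
        · obtain ⟨b, hb, rfl⟩ := Finset.mem_image.1 hyz
          obtain ⟨e, he, f, hf, rfl⟩ := Finset.mem_mul.1 hz1
          refine Finset.mem_union_right _ (Finset.mem_biUnion.2
            ⟨b * e, Finset.mul_mem_mul hb he, Finset.mem_sdiff.2 ⟨?_, hyF⟩⟩)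
          exact Finset.mem_image.2 ⟨f, hf, mul_assoc _ _ _⟩
    _ ≤ _ := by
        refine mul_le_mul_of_nonneg_left ?_ hε.le
        have h1 := Finset.sum_union_inter (f := w) (s₁ := (F n).filter fun x => x ∈ Y)
          (s₂ := D.biUnion fun d => (F n).image (fun x => d * x) \ F n)
        have h2 : 0 ≤ ∑ x ∈ ((F n).filter fun x => x ∈ Y) ∩
          D.biUnion fun d => (F n).image (fun x => d * x) \ F n, w x :=
          Finset.sum_nonneg fun x _ => (hw x).le
        have h3 := sum_biUnion_le_of_nonneg D (fun d => (F n).image (fun x => d * x) \ F n)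
          fun x => (hw x).le
        linarith

/-- Adjoining disjoint tiles to a partition whose nontrivial classes do not meet them. -/
def Setoid.adjoinTiles {Γ : Type*} (r : Setoid Γ) (Z : Set Γ) (T : Γ → Finset Γ)
    (hdisj : ∀ z ∈ Z, ∀ z' ∈ Z, ∀ y ∈ T z, y ∈ T z' → z = z')
    (hr : ∀ z ∈ Z, ∀ y ∈ T z, ∀ x, r x y → x = y) : Setoid Γ where
  r x y := r x y ∨ ∃ z ∈ Z, x ∈ T z ∧ y ∈ T z
  iseqv :=
    { refl := fun x => Or.inl (r.refl x)
      symm := by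
        rintro x y (h | ⟨z, hz, h1, h2⟩)
        · exact Or.inl (r.symm h)
        · exact Or.inr ⟨z, hz, h2, h1⟩
      trans := by
        rintro x y u (h | ⟨z, hz, h1, h2⟩) (h' | ⟨z', hz', h3, h4⟩)
        · exact Or.inl (r.trans h h')
        · rw [hr z' hz' y h3 x h]
          exact Or.inr ⟨z', hz', h3, h4⟩
        · rw [hr z hz y h2 u (r.symm h')]
          exact Or.inr ⟨z, hz, h1, h2⟩
        · obtain rfl := hdisj z hz z' hz' y h2 h3
          exact Or.inr ⟨z, hz, h1, h4⟩ }

/-- In a weighted hyperfinite group there is a partition with classes of bounded size for which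
almost all points, with respect to the mean of a weighted Følner sequence, stay in their class
under given translations. -/
theorem exists_setoid_setMean_le {Γ : Type*} [Group Γ] {w : Γ → ℝ} (hw : ∀ x, 0 < w x)
    {F : ℕ → Finset Γ} (hF : IsWeightedFolner w F) {ω : Ultrafilter ℕ} (hω : ∀ n, ω ≠ pure n)
    {c : Γ → ℝ} (hc0 : ∀ g, 0 ≤ c g) (hc : ∀ g x, w (g * x) ≤ c g * w x)
    (hΓ : IsWeightedHyperfiniteGroup Γ) (L : Finset Γ) {ε : ℝ} (hε : 0 < ε) :
    ∃ (r : Setoid Γ) (Q : Finset Γ), (∀ x y, r x y → y * x⁻¹ ∈ Q) ∧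
      setMean w F ω {x | ∃ g ∈ L, ¬ r x (g * x)} ≤ ε := by
  obtain ⟨η, hη, rfl⟩ : ∃ η, 0 < η ∧ ε = η + η := ⟨ε / 2, by positivity, by ring⟩
  set δ := η / (2 * (L.card + 1)) with hδ
  have hδpos : 0 < δ := by positivity
  have hδη : 2 * (δ * (L.card + 1)) ≤ η := by
    rw [hδ]
    field_simp
    exact le_rfl
  obtain ⟨Q, hQ⟩ := hΓ.exists_setoid L hδpos
  replace hQ := fun V => hQ V w fun x => (hw x).le
  -- The first factors are the loss in choosing a shape; the sum over `Q` is the loss in passing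
  -- from centres to the union of a maximal disjoint family.
  set κ : ℝ := 2 * (2 ^ Q.card * ∑ q ∈ Q, c q⁻¹) with hκ
  have hκ0 : 0 ≤ κ := by
    have : 0 ≤ ∑ q ∈ Q, c q⁻¹ := Finset.sum_nonneg fun q _ => hc0 _
    positivity
  -- Only pairs meeting the covered set `Y` count, since `r` is still trivial off `Y`.
  let bad : Setoid Γ → Set Γ → Set Γ := fun r Y =>
    {x | ∃ g ∈ L, ¬ r x (g * x) ∧ (x ∈ Y ∨ g * x ∈ Y)}
  let 𝒮 : Set ℝ := {t | ∃ (r : Setoid Γ) (Y : Set Γ), (∃ Q : Finset Γ, ∀ x y, r x y → y * x⁻¹ ∈ Q) ∧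
    (∀ x y, r x y → x = y ∨ (x ∈ Y ∧ y ∈ Y)) ∧ setMean w F ω (bad r Y) ≤ η * setMean w F ω Y ∧
    setMean w F ω Y = t}
  have h𝒮ne : 𝒮.Nonempty := by
    refine ⟨_, ⊥, ∅, ⟨{1}, ?_⟩, fun x y h => Or.inl h, ?_, rfl⟩
    · rintro x y rfl
      simp
    · have : bad ⊥ ∅ = ∅ := by
        ext x
        simp [bad]
      rw [this, setMean_empty hw, mul_zero]
  have hle1 : ∀ Y, setMean w F ω Y ≤ 1 := fun Y =>
    (setMean_mono hw F ω (Set.subset_univ Y)).trans (setMean_univ hw hF.1 ω).le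
  have h𝒮bdd : BddAbove 𝒮 := by
    refine ⟨1, ?_⟩
    rintro _ ⟨r, Y, -, -, -, rfl⟩
    exact hle1 Y
  have hgain : 0 < η / (κ + 1) := by positivity
  -- The supremum need not be attained; being within the guaranteed gain `η / (κ + 1)` of it is
  -- enough.
  obtain ⟨_, ⟨r, Y, ⟨Q', hrQ⟩, hrY, hbad, rfl⟩, hsup⟩ :=
    exists_lt_of_lt_csSup h𝒮ne (sub_lt_self (sSup 𝒮) hgain)
  by_cases hA : setMean w F ω Yᶜ ≤ η
  · refine ⟨r, Q', hrQ, ?_⟩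
    have hsub : {x | ∃ g ∈ L, ¬ r x (g * x)} ⊆ bad r Y ∪ Yᶜ := by
      rintro x ⟨g, hg, hx⟩
      by_cases hxY : x ∈ Y
      · exact Or.inl ⟨g, hg, hx, Or.inl hxY⟩
      · exact Or.inr hxY
    refine (setMean_mono hw F ω hsub).trans ((setMean_union_le hw F ω _ _).trans ?_)
    refine add_le_add (hbad.trans ?_) hA
    exact mul_le_of_le_one_right hη.le (hle1 Y)
  exfalso
  push Not at hA
  obtain ⟨B, hBQ, hB1, hAB⟩ := exists_tile_shape hw hF hω hc hη hδη hQ Yᶜ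
  obtain ⟨Z, hZ, hdisj, hmax⟩ := exists_maximal_disjoint_tiles B hB1
    {x | IsGoodTile w Yᶜ L η (B.image fun b => b * x)}
  set T : Γ → Finset Γ := fun z => B.image fun b => b * z with hT
  set Y₁ : Set Γ := {x | ∃ z ∈ Z, x ∈ T z} with hY₁
  have hTA : ∀ z ∈ Z, ∀ y ∈ T z, y ∉ Y := fun z hz y hy => (hZ hz).1 hy
  have hYdisj : Disjoint Y Y₁ := Set.disjoint_right.2 fun y ⟨z, hz, hy⟩ => hTA z hz y hy
  have hYsum := setMean_union_of_disjoint hw F ω hYdisj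
  have hbd : setMean w F ω {x | ∃ z ∈ Z, x ∈ tileBoundary Yᶜ L (T z)} ≤ η * setMean w F ω Y₁ :=
    setMean_tileBoundary_le hw hF hω hη hZ hdisj
  -- By maximality each available centre is moved into `Y₁` by an element of `Q`, so
  -- quasi-invariance bounds the mean of the centres.
  have hcover : setMean w F ω {x | IsGoodTile w Yᶜ L η (T x)} ≤
      (∑ q ∈ Q, c q⁻¹) * setMean w F ω Y₁ := by
    have hsub : {x | IsGoodTile w Yᶜ L η (T x)} ⊆ ⋃ q ∈ Q, (fun x => q * x) ⁻¹' Y₁ := by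
      intro x hx
      obtain ⟨b, hb, z, hz, hbx⟩ := hmax x hx
      exact Set.mem_biUnion (hBQ hb) ⟨z, hz, hbx⟩
    refine (setMean_mono hw F ω hsub).trans ((setMean_biUnion_le hw F ω _ _).trans ?_)
    rw [Finset.sum_mul]
    exact Finset.sum_le_sum fun q _ => setMean_preimage_le hw hF hω hc0 hc q Y₁
  have hY₁gain : η / (κ + 1) ≤ setMean w F ω Y₁ := by
    rw [div_le_iff₀ (by positivity)]
    have h1 : setMean w F ω Yᶜ ≤ κ * setMean w F ω Y₁ := by
      refine hAB.trans ?_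
      rw [hκ, mul_assoc, mul_assoc]
      gcongr
    have h2 := setMean_nonneg hw F ω Y₁
    linarith
  have hmem : setMean w F ω (Y ∪ Y₁) ∈ 𝒮 := by
    refine ⟨r.adjoinTiles Z T hdisj ?_, Y ∪ Y₁, ⟨Q' ∪ B * B⁻¹, ?_⟩, ?_, ?_, rfl⟩
    · intro z hz y hy x hxy
      exact (hrY x y hxy).resolve_right fun h => hTA z hz y hy h.2
    · rintro x y (h | ⟨z, hz, hx, hy⟩)
      · exact Finset.mem_union_left _ (hrQ x y h)
      · obtain ⟨b, hb, rfl⟩ := Finset.mem_image.1 hx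
        obtain ⟨b', hb', rfl⟩ := Finset.mem_image.1 hy
        refine Finset.mem_union_right _ ?_
        have : b' * z * (b * z)⁻¹ = b' * b⁻¹ := by group
        rw [this]
        exact Finset.mul_mem_mul hb' (Finset.inv_mem_inv hb)
    · rintro x y (h | ⟨z, hz, hx, hy⟩)
      · exact (hrY x y h).imp_right fun h => ⟨Or.inl h.1, Or.inl h.2⟩
      · exact Or.inr ⟨Or.inr ⟨z, hz, hx⟩, Or.inr ⟨z, hz, hy⟩⟩
    -- A new bad pair meeting `Y` was already bad for `r`. Any other lies in `Yᶜ` and crosses a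
    -- tile's boundary relative to `Yᶜ`, so the two estimates add without loss.
    · rw [hYsum, mul_add]
      refine (setMean_mono hw F ω (B := bad r Y ∪ {x | ∃ z ∈ Z, x ∈ tileBoundary Yᶜ L (T z)})
        ?_).trans ((setMean_union_le hw F ω _ _).trans (add_le_add hbad hbd))
      rintro x ⟨g, hg, hx, hxY⟩
      have hx1 : ¬ r x (g * x) := fun h => hx (Or.inl h)
      have hx2 : ∀ z ∈ Z, ¬ (x ∈ T z ∧ g * x ∈ T z) := fun z hz h => hx (Or.inr ⟨z, hz, h⟩)
      by_cases h : x ∈ Y ∨ g * x ∈ Y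
      · exact Or.inl ⟨g, hg, hx1, h⟩
      push Not at h
      refine Or.inr ?_
      obtain ⟨z, hz, hxz⟩ : ∃ z ∈ Z, x ∈ T z ∨ g * x ∈ T z := by
        rcases hxY with (h' | ⟨z, hz, h'⟩) | (h' | ⟨z, hz, h'⟩)
        · exact (h.1 h').elim
        · exact ⟨z, hz, Or.inl h'⟩
        · exact (h.2 h').elim
        · exact ⟨z, hz, Or.inr h'⟩
      refine ⟨z, hz, mem_tileBoundary.2 ⟨h.1, g, hg, h.2, fun hiff => ?_⟩⟩
      have := hx2 z hz
      tauto
  have := le_csSup h𝒮bdd hmem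
  linarith

end Exhaustion

/-! ### Hyperfiniteness of the action on βΓ -/

section Amenability

theorem countable_of_closure_eq_top {Γ : Type*} [Group Γ] {S : Finset Γ}
    (hS : Subgroup.closure (S : Set Γ) = ⊤) : Countable Γ := by
  rw [FreeGroup.closure_eq_range] at hS
  have h := MonoidHom.range_eq_top.1 hS
  exact h.countable

/-- The relation on ultrafilters that a partition of a group with bounded classes induces on each
orbit. -/
def ultrafilterSetoid {Γ : Type*} [Group Γ] (r : Setoid Γ) : Setoid (Ultrafilter Γ) where
  r z z' := ∃ g : Γ, z' = g • z ∧ {x | r x (g * x)} ∈ z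
  iseqv :=
    { refl := fun z => ⟨1, (one_smul Γ z).symm, Filter.univ_mem' fun x => by
        simp⟩
      symm := by
        rintro z _ ⟨g, rfl, h⟩
        refine ⟨g⁻¹, (inv_smul_smul g z).symm, ?_⟩
        change (fun x => g * x) ⁻¹' {x | r x (g⁻¹ * x)} ∈ z
        refine mem_of_superset h fun x hx => ?_
        simpa only [Set.mem_preimage, Set.mem_ofPred_eq, inv_mul_cancel_left] using r.symm hx
      trans := by
        rintro z _ _ ⟨g, rfl, h⟩ ⟨k, rfl, h'⟩
        refine ⟨k * g, (mul_smul k g z).symm, ?_⟩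
        change (fun x => g * x) ⁻¹' {x | r x (k * x)} ∈ z at h'
        refine mem_of_superset (inter_mem h h') fun x hx => ?_
        have := r.trans hx.1 hx.2
        rwa [← mul_assoc] at this }

theorem mem_of_setOf_rel_mem {Γ : Type*} [Group Γ] {r : Setoid Γ} {Q : Finset Γ}
    (hQ : ∀ x y, r x y → y * x⁻¹ ∈ Q) {g : Γ} {z : Ultrafilter Γ}
    (h : {x | r x (g * x)} ∈ z) : g ∈ Q := by
  obtain ⟨x, hx⟩ := Ultrafilter.nonempty_of_mem h
  simpa using hQ x _ hx

/-- Bounded displacement leaves finitely many `g`; each contributes the graph of a translation,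
closed because βΓ is Hausdorff, cut by a clopen condition. -/
theorem isClosed_ultrafilterSetoid {Γ : Type*} [Group Γ] {r : Setoid Γ} {Q : Finset Γ}
    (hQ : ∀ x y, r x y → y * x⁻¹ ∈ Q) :
    IsClosed {p : Ultrafilter Γ × Ultrafilter Γ | ultrafilterSetoid r p.1 p.2} := by
  have : {p : Ultrafilter Γ × Ultrafilter Γ | ultrafilterSetoid r p.1 p.2} =
      ⋃ g ∈ Q, {p | p.2 = g • p.1} ∩ {p | {x | r x (g * x)} ∈ p.1} := by
    ext p
    simp only [Set.mem_iUnion]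
    constructor
    · rintro ⟨g, h1, h2⟩
      exact ⟨g, mem_of_setOf_rel_mem hQ h2, h1, h2⟩
    · rintro ⟨g, -, h1, h2⟩
      exact ⟨g, h1, h2⟩
  rw [this]
  refine isClosed_biUnion_finset fun g _ => IsClosed.inter ?_ ?_
  · exact isClosed_eq continuous_snd ((continuous_smul_ultrafilter g).comp continuous_fst)
  · exact (ultrafilter_isClosed_basic _).preimage continuous_fst

theorem finite_ultrafilterSetoid {Γ : Type*} [Group Γ] {r : Setoid Γ} {Q : Finset Γ}
    (hQ : ∀ x y, r x y → y * x⁻¹ ∈ Q) (z : Ultrafilter Γ) :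
    {z' | ultrafilterSetoid r z z'}.Finite := by
  refine (Q.finite_toSet.image fun g => g • z).subset ?_
  rintro _ ⟨g, rfl, h⟩
  exact ⟨g, mem_of_setOf_rel_mem hQ h, rfl⟩

theorem isAmenableGroup_of_subsingleton (H : Type*) [Group H] [Subsingleton H] :
    IsAmenableGroup H := by
  classical
  refine ⟨fun A => if (1 : H) ∈ A then 1 else 0, fun A => ?_, by simp, fun A B h => ?_, fun g A => ?_⟩
  · dsimp only
    split_ifs <;> norm_num
  · have : (1 : H) ∈ A → (1 : H) ∉ B := fun h1 => Set.disjoint_left.1 h h1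
    by_cases h1 : (1 : H) ∈ A <;> by_cases h2 : (1 : H) ∈ B <;> simp_all
  · rw [Subsingleton.elim g 1]
    simp

open scoped Classical in
-- Partitions with errors `2⁻ʲ` for the first `j` elements of Γ are intersected over `j ≥ k`: the
-- relations increase with `k`, and their classes are finite already because of `j = k`. By
-- Borel–Cantelli, almost every `z` is related to `g • z` for all large `j`; countability of Γ
-- handles all `g` at once.
theorem isHyperfiniteAction_folnerMeasure {Γ : Type*} [Group Γ] [Countable Γ] {w : Γ → ℝ}
    (hw : ∀ x, 0 < w x) {F : ℕ → Finset Γ} (hF : IsWeightedFolner w F) {ω : Ultrafilter ℕ}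
    (hω : ∀ n, ω ≠ pure n) {c : Γ → ℝ} (hc0 : ∀ g, 0 ≤ c g)
    (hc : ∀ g x, w (g * x) ≤ c g * w x) (hΓ : IsWeightedHyperfiniteGroup Γ) :
    IsHyperfiniteAction Γ (folnerMeasure w hw F ω) := by
  obtain ⟨e, he⟩ := exists_surjective_nat Γ
  choose r Q hQ hr using fun j : ℕ => exists_setoid_setMean_le hw hF hω hc0 hc hΓ
    ((Finset.range j).image e) (ε := (1 / 2) ^ j) (by positivity)
  refine ⟨fun k =>
    { r := fun z z' => ∀ j ≥ k, ultrafilterSetoid (r j) z z'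
      iseqv :=
        { refl := fun z j _ => (ultrafilterSetoid (r j)).refl z
          symm := fun h j hj => (ultrafilterSetoid (r j)).symm (h j hj)
          trans := fun h h' j hj => (ultrafilterSetoid (r j)).trans (h j hj) (h' j hj) } },
    fun k => ?_, fun k z => ?_, fun k z z' h j hj => h j ((Nat.le_succ k).trans hj),
    fun k z z' h => ?_, ?_⟩
  · have : {p : Ultrafilter Γ × Ultrafilter Γ | ∀ j ≥ k, ultrafilterSetoid (r j) p.1 p.2} =
        ⋂ j, ⋂ (_ : j ≥ k), {p | ultrafilterSetoid (r j) p.1 p.2} := by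
      ext p
      simp
    have hclosed : IsClosed
        {p : Ultrafilter Γ × Ultrafilter Γ | ∀ j ≥ k, ultrafilterSetoid (r j) p.1 p.2} :=
      this ▸ isClosed_iInter fun j => isClosed_iInter fun _ => isClosed_ultrafilterSetoid (hQ j)
    exact MeasurableSet.of_compl
      (MeasurableSpace.measurableSet_generateFrom hclosed.isOpen_compl)
  · exact (finite_ultrafilterSetoid (hQ k) z).subset fun z' h => h k le_rfl
  · obtain ⟨g, hg, -⟩ := h k le_rfl
    refine (MulAction.orbitRel Γ (Ultrafilter Γ)).symm ?_
    exact ⟨g, hg.symm⟩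
  · have key : ∀ g : Γ, ∀ᵐ z ∂(folnerMeasure w hw F ω), ∃ k, ∀ j ≥ k,
        {x | r j x (g * x)} ∈ z := by
      intro g
      obtain ⟨i, rfl⟩ := he g
      -- The shift by `i + 1` ensures that `e i` is among the translations controlled by the
      -- partition.
      have hsum : ∑' j : ℕ, folnerMeasure w hw F ω
          {z | {x | ¬ r (j + (i + 1)) x (e i * x)} ∈ z} ≠ ⊤ := by
        refine ne_top_of_le_ne_top
          (summable_geometric_of_lt_one (r := (1 / 2 : ℝ)) (by norm_num)
            (by norm_num)).tsum_ofReal_ne_top (ENNReal.tsum_le_tsum fun j => ?_)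
        rw [folnerMeasure_basic]
        refine ENNReal.ofReal_le_ofReal (((setMean_mono hw F ω ?_).trans
          (hr (j + (i + 1)))).trans ?_)
        · intro x hx
          exact ⟨e i, Finset.mem_image_of_mem _ (Finset.mem_range.2 (by omega)), hx⟩
        · exact pow_le_pow_of_le_one (by norm_num) (by norm_num) (by omega)
      filter_upwards [ae_eventually_notMem hsum] with z hz
      obtain ⟨N, hN⟩ := eventually_atTop.1 hz
      refine ⟨N + (i + 1), fun j hj => ?_⟩
      obtain ⟨m, rfl⟩ := Nat.exists_eq_add_of_le hj
      have := hN (N + m) (by omega)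
      rw [show N + m + (i + 1) = N + (i + 1) + m by omega] at this
      exact (Ultrafilter.compl_mem_iff_notMem (s := {x | ¬ r (N + (i + 1) + m) x (e i * x)})
        (f := z)).2 this |> fun h => mem_of_superset h fun x hx => not_not.1 hx
    filter_upwards [ae_all_iff.2 key] with z hz z' hzz'
    obtain ⟨g, hg⟩ := (MulAction.orbitRel Γ (Ultrafilter Γ)).symm hzz'
    obtain ⟨k, hk⟩ := hz g
    exact ⟨k, fun j hj => ⟨g, hg.symm, hk j hj⟩⟩

end Amenability

theorem theorem3 {Γ : Type*} [Group Γ] (S : Finset Γ)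
    (hS : Subgroup.closure (S : Set Γ) = ⊤)
    (w : Γ → ℝ) (hw : ∀ x, 0 < w x) (hbal : IsBalanced (leftCayleyGraph S) w)
    (F : ℕ → Finset Γ) (hF : IsWeightedFolner w F)
    (ω : Ultrafilter ℕ) (hω : ∀ n, ω ≠ pure n)
    (hΓ : IsWeightedHyperfiniteGroup Γ) :
    IsProbabilityMeasure (folnerMeasure w hw F ω) ∧
      (∀ g : Γ, g ≠ 1 → ∀ z : Ultrafilter Γ, g • z ≠ z) ∧
      IsZimmerAmenable Γ (folnerMeasure w hw F ω) := by
  obtain ⟨c, hc0, hc⟩ := exists_weight_translate_le hS hw hbal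
  have := countable_of_closure_eq_top hS
  refine ⟨⟨?_⟩, fun g hg z => smul_ultrafilter_ne hg z,
    quasiMeasurePreserving_smul hw hF hω hc0 hc,
    isHyperfiniteAction_folnerMeasure hw hF hω hc0 hc hΓ, ?_⟩
  · have : (Set.univ : Set (Ultrafilter Γ)) = {u | Set.univ ∈ u} := by
      ext u
      exact iff_of_true trivial Filter.univ_mem
    rw [this, folnerMeasure_basic, setMean_univ hw hF.1, ENNReal.ofReal_one]
  · refine Filter.Eventually.of_forall fun z => ?_
    have : Subsingleton (MulAction.stabilizer Γ z) := by
      refine ⟨fun a b => Subtype.ext ?_⟩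
      have h1 : ∀ a : MulAction.stabilizer Γ z, (a : Γ) = 1 := fun a => by
        by_contra h
        exact smul_ultrafilter_ne h z a.2
      rw [h1 a, h1 b]
    exact isAmenableGroup_of_subsingleton _
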